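/- Let $\xi>0$. Consider the spin-$1/2$ chain on $\mathbb{Z}$ with nearest-neighbour interaction $$ h(n,n+1) = -\operatorname{sech}(\xi)\, \boldsymbol{S}_n\cdot\boldsymbol{S}_{n+1} - (1-\operatorname{sech}\xi)\, S^3_nS^3_{n+1} + \tfrac12\tanh(\xi)\,(S^3_n-S^3_{n+1}), $$ where $\boldsymbol{S}_n=(S^1_n,S^2_n,S^3_n)$ are the spin-$1/2$ matrices at site $n$. For finite $\Lambda\subset\mathbb{Z}$ let $H_\Lambda=\sum_{n,n+1\in\Lambda}h(n,n+1)$ act on $\mathcal{H}_\Lambda=\bigotimes_{n\in\Lambda}\mathbb{C}^2$ and let $\mathcal{A}_\Lambda=\mathcal{B}(\mathcal{H}_\Lambda)$. Let $\mathcal{A}$ be the quasilocal algebra, i.e. the $C^*$-algebra that is the norm closure of $\bigcup_\Lambda\mathcal{A}_\Lambda$, and for local $X$ (that is, $X\in\mathcal{A}_\Lambda$ with $\Lambda$ finite) let $\delta(X)=\lim_{\Lambda'\nearrow\mathbb{Z}}[H_{\Lambda'},X]$. A state $\omega$ on $\mathcal{A}$ is an infinite-volume ground state if $\omega(X^*\delta(X))\ge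 0$ for all local $X$; its spectral gap is the greatest number $\gamma$ such that $$ \omega(\delta(X)^*\delta^2(X))\ \ge\ \gamma\,\omega(\delta(X)^*\delta(X))\qquad\text{for all local } X . $$ Let $\Lambda_i=[a_i,b_i]\subset\mathbb{Z}$ be a sequence (or net) of finite intervals with $a_i\to-\infty$ and $b_i\to+\infty$, and for each $i$ let $\psi_i\in\mathcal{H}_{\Lambda_i}$ be a unit vector that is an eigenvector of $H_{\Lambda_i}$ for its lowest eigenvalue (a finite-volume kink ground state). Let $\omega$ be a state on $\mathcal{A}$ that is the weak-$*$ limit of the states $\langle\psi_i,\,\cdot\,\psi_i\rangle$, i.e. $\omega(X)=\lim_i\langle\psi_i,X\psi_i\rangle$ for every local $X$. Then $\omega$ is an infinite-volume ground state, and its spectral gap is exactly $1-\operatorname{sech}\xi$. -/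

import Mathlib

namespace XXZ

open Filter Topology
open scoped ComplexOrder

/-! ### Finite volume

The basis state `0 : Fin 2` is spin up and `1 : Fin 2` is spin down.  For a finite `Λ ⊆ ℤ` the space
`⨂_{x ∈ Λ} ℂ²` is identified with `EuclideanSpace ℂ (Λ → Fin 2)` through its orthonormal basis of
spin configurations, and `B(⨂_{x ∈ Λ} ℂ²)` with the matrices indexed by configurations. -/

/-- The observables localized in the finite set `Λ`. -/
abbrev LocalMatrix (Λ : Finset ℤ) : Type := Matrix (Λ → Fin 2) (Λ → Fin 2) ℂ

/-- The Hilbert space of the finite volume `Λ`. -/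
abbrev LocalSpace (Λ : Finset ℤ) : Type := EuclideanSpace ℂ (Λ → Fin 2)

/-- The one-site spin-1/2 matrix `S¹`. -/
noncomputable def S1 : Matrix (Fin 2) (Fin 2) ℂ := !![0, 1 / 2; 1 / 2, 0]

/-- The matrix `S²`. -/
noncomputable def S2 : Matrix (Fin 2) (Fin 2) ℂ := !![0, -Complex.I / 2; Complex.I / 2, 0]

/-- The matrix `S³`. -/
noncomputable def S3 : Matrix (Fin 2) (Fin 2) ℂ := !![1 / 2, 0; 0, -1 / 2]

/-- The one-site matrix `M` acting at the site `x`, tensored with the identity elsewhere. -/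
noncomputable def atSite {Λ : Finset ℤ} (x : Λ) (M : Matrix (Fin 2) (Fin 2) ℂ) : LocalMatrix Λ :=
  fun ρ τ => if ∀ y, y ≠ x → ρ y = τ y then M (ρ x) (τ x) else 0

/-- The two-site interaction
`- sech ξ 𝐒ₓ·𝐒_y - (1 - sech ξ) S³ₓ S³_y + (1/2) tanh ξ (S³ₓ - S³_y)`. -/
noncomputable def interaction (ξ : ℝ) {Λ : Finset ℤ} (x y : Λ) : LocalMatrix Λ :=
  -((1 / Real.cosh ξ : ℝ) : ℂ) •
      (atSite x S1 * atSite y S1 + atSite x S2 * atSite y S2 + atSite x S3 * atSite y S3)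
    - ((1 - 1 / Real.cosh ξ : ℝ) : ℂ) • (atSite x S3 * atSite y S3)
    + ((1 / 2 * Real.tanh ξ : ℝ) : ℂ) • (atSite x S3 - atSite y S3)

/-- The Hamiltonian of the finite volume `Λ`: the sum of the interactions of all nearest-neighbour
pairs `x, x + 1` in `Λ`. -/
noncomputable def hamiltonian (ξ : ℝ) (Λ : Finset ℤ) : LocalMatrix Λ :=
  ∑ x : Λ, if hx : (x : ℤ) + 1 ∈ Λ then interaction ξ x ⟨(x : ℤ) + 1, hx⟩ else 0

/-- `ψ` is a normalized ground state vector of the finite volume `Λ`: an eigenvector of the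
Hamiltonian whose eigenvalue is the minimal energy. -/
def IsGroundVector (ξ : ℝ) (Λ : Finset ℤ) (ψ : LocalSpace Λ) : Prop :=
  ‖ψ‖ = 1 ∧ ∃ E : ℝ, Matrix.toEuclideanLin (hamiltonian ξ Λ) ψ = (E : ℂ) • ψ ∧
    ∀ φ : LocalSpace Λ,
      E * ‖φ‖ ^ 2 ≤ (inner ℂ φ (Matrix.toEuclideanLin (hamiltonian ξ Λ) φ)).re

/-- The restriction of a configuration to a smaller set. -/
def restrict {Λ Λ' : Finset ℤ} (h : Λ ⊆ Λ') (ρ : Λ' → Fin 2) : Λ → Fin 2 :=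
  fun x => ρ ⟨x, h x.2⟩

/-- The inclusion of the observables of `Λ` in those of `Λ' ⊇ Λ`, by tensoring with the identity
on `Λ' \ Λ`. -/
noncomputable def extend {Λ Λ' : Finset ℤ} (h : Λ ⊆ Λ') (A : LocalMatrix Λ) : LocalMatrix Λ' :=
  fun ρ τ => if ∀ y : Λ', (y : ℤ) ∉ Λ → ρ y = τ y then A (restrict h ρ) (restrict h τ) else 0

/-- The expectation `⟨ψ, A ψ⟩` of the observable `A` of `Λ` in the vector `ψ` of the volume `Λ'`,
where `Λ ⊆ Λ'` (and `0` if `Λ` is not contained in `Λ'`). -/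
noncomputable def expectation {Λ' : Finset ℤ} (ψ : LocalSpace Λ') {Λ : Finset ℤ}
    (A : LocalMatrix Λ) : ℂ :=
  if h : Λ ⊆ Λ' then inner ℂ ψ (Matrix.toEuclideanLin (extend h A) ψ) else 0

/-! ### The quasilocal algebra

The algebras of local observables are represented faithfully and compatibly by operators on
`ℓ²({↑, ↓}^ℤ)`, a local observable acting on the spins of its finite set only.  The quasilocal
algebra is the C*-algebra that they generate there. -/

/-- The space `ℓ²` over all spin configurations on `ℤ`. -/
abbrev ConfigSpace : Type := lp (fun _ : ℤ → Fin 2 => ℂ) 2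

/-- The configuration that is `τ` on `Λ` and `σ` elsewhere. -/
def overwrite {Λ : Finset ℤ} (τ : Λ → Fin 2) (σ : ℤ → Fin 2) : ℤ → Fin 2 :=
  fun x => if h : x ∈ Λ then τ ⟨x, h⟩ else σ x

/-- The coordinates of the matrix unit `|ρ⟩⟨τ|` of `Λ` applied to a vector. -/
def matrixUnitFun {Λ : Finset ℤ} (ρ τ : Λ → Fin 2) (ψ : (ℤ → Fin 2) → ℂ) (σ : ℤ → Fin 2) : ℂ :=
  if (fun x : Λ => σ x) = ρ then ψ (overwrite τ σ) else 0

theorem sum_matrixUnitFun_le {Λ : Finset ℤ} (ρ τ : Λ → Fin 2) (ψ : ConfigSpace)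
    (s : Finset (ℤ → Fin 2)) :
    ∑ σ ∈ s, ‖matrixUnitFun ρ τ ψ σ‖ ^ (2 : ENNReal).toReal ≤ ‖ψ‖ ^ (2 : ENNReal).toReal := by
  classical
  set t := s.filter (fun σ => (fun x : Λ => σ x) = ρ) with ht
  have hinj : Set.InjOn (overwrite τ) (t : Set (ℤ → Fin 2)) := by
    intro σ hσ σ' hσ' h
    simp only [ht, Finset.coe_filter, Set.mem_ofPred_eq] at hσ hσ'
    funext x
    by_cases hx : x ∈ Λ
    · exact (congrFun hσ.2 ⟨x, hx⟩).trans (congrFun hσ'.2 ⟨x, hx⟩).symm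
    · simpa [overwrite, hx] using congrFun h x
  calc ∑ σ ∈ s, ‖matrixUnitFun ρ τ ψ σ‖ ^ (2 : ENNReal).toReal
      = ∑ σ ∈ t, ‖ψ (overwrite τ σ)‖ ^ (2 : ENNReal).toReal := by
        rw [ht, Finset.sum_filter]
        refine Finset.sum_congr rfl fun σ _ => ?_
        unfold matrixUnitFun
        split_ifs <;> simp
    _ = ∑ σ ∈ t.image (overwrite τ), ‖ψ σ‖ ^ (2 : ENNReal).toReal :=
        (Finset.sum_image (f := fun σ => ‖ψ σ‖ ^ (2 : ENNReal).toReal) hinj).symm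
    _ ≤ ‖ψ‖ ^ (2 : ENNReal).toReal := lp.sum_rpow_le_norm_rpow (by simp) ψ _

/-- The matrix unit `|ρ⟩⟨τ|` of `Λ`, tensored with the identity on the complement of `Λ`. -/
noncomputable def matrixUnit {Λ : Finset ℤ} (ρ τ : Λ → Fin 2) : ConfigSpace →L[ℂ] ConfigSpace :=
  LinearMap.mkContinuous
    { toFun := fun ψ => ⟨matrixUnitFun ρ τ ψ, memℓp_gen' (sum_matrixUnitFun_le ρ τ ψ)⟩
      map_add' := fun ψ φ => by
        ext σ
        change matrixUnitFun ρ τ _ σ = matrixUnitFun ρ τ _ σ + matrixUnitFun ρ τ _ σ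
        unfold matrixUnitFun
        split_ifs <;> simp
      map_smul' := fun c ψ => by
        ext σ
        change matrixUnitFun ρ τ _ σ = c • matrixUnitFun ρ τ _ σ
        unfold matrixUnitFun
        split_ifs <;> simp }
    1 (fun ψ => by
      rw [one_mul]
      exact lp.norm_le_of_forall_sum_le (by simp) (norm_nonneg _) (sum_matrixUnitFun_le ρ τ ψ))

/-- The local observable `A` of `Λ` as an operator on `ℓ²({↑, ↓}^ℤ)`. -/
noncomputable def localOp (Λ : Finset ℤ) (A : LocalMatrix Λ) : ConfigSpace →L[ℂ] ConfigSpace :=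
  ∑ ρ : Λ → Fin 2, ∑ τ : Λ → Fin 2, A ρ τ • matrixUnit ρ τ

/-- The quasilocal observable algebra: the norm closure of the algebra of local observables. -/
noncomputable def quasilocal : StarSubalgebra ℂ (ConfigSpace →L[ℂ] ConfigSpace) :=
  (StarAlgebra.adjoin ℂ (⋃ Λ : Finset ℤ, Set.range (localOp Λ))).topologicalClosure

/-- A local observable as an element of the quasilocal algebra. -/
noncomputable def localObs (Λ : Finset ℤ) (A : LocalMatrix Λ) : quasilocal :=
  ⟨localOp Λ A, StarSubalgebra.le_topologicalClosure _
    (StarAlgebra.subset_adjoin ℂ _ (Set.mem_iUnion.2 ⟨Λ, A, rfl⟩))⟩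

/-- A state: a positive linear functional with `ω 1 = 1`. -/
def IsState (ω : quasilocal →ₗ[ℂ] ℂ) : Prop :=
  (∀ X : quasilocal, 0 ≤ ω (star X * X)) ∧ ω 1 = 1

/-- The derivation `δ(X) = lim_{Λ ↗ ℤ} [H_Λ, X]`.  On local `X` the net of commutators is
eventually constant, and `δ(X)` is again local. -/
noncomputable def derivation (ξ : ℝ) (X : quasilocal) : quasilocal :=
  limUnder atTop fun Λ : Finset ℤ =>
    localObs Λ (hamiltonian ξ Λ) * X - X * localObs Λ (hamiltonian ξ Λ)

/-- `ω` is an infinite volume ground state: `ω(X* δ(X)) ≥ 0` for every local `X`. -/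
def IsGroundState (ξ : ℝ) (ω : quasilocal →ₗ[ℂ] ℂ) : Prop :=
  IsState ω ∧ ∀ (Λ : Finset ℤ) (A : LocalMatrix Λ),
    0 ≤ ω (star (localObs Λ A) * derivation ξ (localObs Λ A))

/-- The numbers `γ` with `ω(δ(X)* δ²(X)) ≥ γ ω(δ(X)* δ(X))` for every local `X`.  (The inequality
in `ℂ` includes that the two sides have the same imaginary part.) -/
def gapBounds (ξ : ℝ) (ω : quasilocal →ₗ[ℂ] ℂ) : Set ℝ :=
  {γ | ∀ (Λ : Finset ℤ) (A : LocalMatrix Λ),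
    (γ : ℂ) * ω (star (derivation ξ (localObs Λ A)) * derivation ξ (localObs Λ A)) ≤
      ω (star (derivation ξ (localObs Λ A)) * derivation ξ (derivation ξ (localObs Λ A)))}

/-- `γ` is the spectral gap above `ω`: the greatest number in `gapBounds ξ ω`. -/
def IsSpectralGap (ξ : ℝ) (ω : quasilocal →ₗ[ℂ] ℂ) (γ : ℝ) : Prop :=
  IsGreatest (gapBounds ξ ω) γ

/-- `ω` is the weak-* limit along `l` of the vector states `⟨ψᵢ, · ψᵢ⟩` of finite volumes `Vᵢ`:
the expectations of every local observable converge. -/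
def IsWeakStarLimit {ι : Type*} (l : Filter ι) (V : ι → Finset ℤ) (ψ : ∀ i, LocalSpace (V i))
    (ω : quasilocal →ₗ[ℂ] ℂ) : Prop :=
  ∀ (Λ : Finset ℤ) (A : LocalMatrix Λ),
    Tendsto (fun i => expectation (ψ i) A) l (𝓝 (ω (localObs Λ A)))

end XXZ

/-! Put `t = tanh ξ` and `c = 1 / (2 cosh ξ)`, so that `t² + 4c² = 1` and `1 - 2c = 1 - sech ξ`. The
shifted interaction `P_n = h(n, n+1) + 1/4` is a projection: it vanishes on parallel neighbours, and
on antiparallel ones it is a 2×2 matrix of trace one and determinant zero. The all-up vector is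
annihilated by every `P_n`, hence so is every finite-volume ground vector, and `ω(P_n) = 0` in the
limit. Only this frustration-freeness is used afterwards. By Cauchy-Schwarz `ω(B P_n) = ω(P_n B) =
0`, so under `ω` the derivation acts as left multiplication by a finite sum `H` of the `P_n`, which
is nonnegative: `ω` is a ground state.

Lower bound. The Temperley-Lieb relation `P_n P_{n+1} P_n = c² P_n` (`bond_bond_succ_bond`) bounds
the cross terms of neighbouring bonds in `H²`, and the remaining cross terms are nonnegative because
those bonds commute. This gives `H² ≥ (1 - 2c) H` under `ω` (`bondSum_sq_ge`), and Cauchy-Schwarz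
for the form of `H` lifts it to `H³ ≥ (1 - 2c) H²` (`bondSum_cube_ge`), the gap inequality.

Upper bound. The magnetization increases from `n` to `n + 1` by `2t` times the probability of a
domain wall there; being bounded, it converges, so walls disappear at `+∞` (`tendsto_gnsNorm_wall`).
In that region a flipped spin hops freely with amplitudes `-c, 1, -c`, that is, with energy `1 - 2c
cos k`. A uniform superposition of flips over `N` sites, moved to `+∞` before `N → ∞`, realizes `k =
0` and yields `γ (1 - 2c)² ≤ (1 - 2c)³` (`gap_le`). -/

set_option linter.unusedSectionVars false

namespace XXZ

open Filter Topology
open scoped ComplexOrder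

/-! ### Positive functionals on a star algebra -/

section Functional

variable {R : Type*} [Ring R] [StarRing R] [Algebra ℂ R] [StarModule ℂ R]

/-- A hermitian positive semidefinite form `(A, B) ↦ ω(A* K B)`. -/
@[reducible]
noncomputable def formCore (ω : R →ₗ[ℂ] ℂ) (K : R) (hK : ∀ A : R, 0 ≤ ω (star A * (K * A))) :
    PreInnerProductSpace.Core ℂ R where
  inner A B := ω (star A * (K * B))
  -- Hermitian symmetry is not assumed: positivity in `ℂ` includes being real, and polarization with
  -- `A + B` and `A + iB` recovers it.
  conj_inner_symm A B := by
    have h1 := (Complex.nonneg_iff.1 (hK (A + B))).2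
    have h2 := (Complex.nonneg_iff.1 (hK (A + Complex.I • B))).2
    have hA := (Complex.nonneg_iff.1 (hK A)).2
    have hB := (Complex.nonneg_iff.1 (hK B)).2
    simp [mul_add, add_mul, ← hA] at h1 h2
    rw [← hB] at h1 h2
    apply Complex.ext
    · simp
      linarith
    · simp
      linarith
  re_inner_nonneg A := (Complex.nonneg_iff.1 (hK A)).1
  add_left A B C := by simp [add_mul]
  smul_left A B r := by simp

theorem norm_form_sq_le (ω : R →ₗ[ℂ] ℂ) (K : R) (hK : ∀ A : R, 0 ≤ ω (star A * (K * A)))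
    (A B : R) :
    ‖ω (star A * (K * B))‖ ^ 2 ≤ (ω (star A * (K * A))).re * (ω (star B * (K * B))).re := by
  have h := @InnerProductSpace.Core.inner_mul_inner_self_le ℂ R _ _ _ (formCore ω K hK) A B
  rw [@InnerProductSpace.Core.norm_inner_symm ℂ R _ _ _ (formCore ω K hK) B A] at h
  rw [sq]
  exact h

/-- The seminorm of the GNS representation of `ω`. -/
noncomputable def gnsNorm (ω : R →ₗ[ℂ] ℂ) (A : R) : ℝ := √(ω (star A * A)).re

variable {ω : R →ₗ[ℂ] ℂ}

theorem gnsNorm_nonneg (A : R) : 0 ≤ gnsNorm ω A := Real.sqrt_nonneg _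

section

variable (hω : ∀ A : R, 0 ≤ ω (star A * A))
include hω

theorem gnsNorm_sq (A : R) : gnsNorm ω A ^ 2 = (ω (star A * A)).re :=
  Real.sq_sqrt (Complex.nonneg_iff.1 (hω A)).1

theorem apply_star_mul_self (A : R) : ω (star A * A) = ((gnsNorm ω A ^ 2 : ℝ) : ℂ) := by
  rw [gnsNorm_sq hω]
  exact Complex.ext (by simp) (by simpa using (Complex.nonneg_iff.1 (hω A)).2.symm)

theorem norm_apply_star_mul_le (A B : R) : ‖ω (star A * B)‖ ≤ gnsNorm ω A * gnsNorm ω B := by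
  have h := norm_form_sq_le ω 1 (by simpa using hω) A B
  simp only [one_mul] at h
  rw [← gnsNorm_sq hω, ← gnsNorm_sq hω, ← mul_pow] at h
  exact le_of_sq_le_sq h (mul_nonneg (gnsNorm_nonneg _) (gnsNorm_nonneg _))

theorem apply_star_mul_comm (A B : R) :
    (starRingEnd ℂ) (ω (star B * A)) = ω (star A * B) := by
  have h := (formCore ω 1 (by simpa using hω)).conj_inner_symm A B
  change (starRingEnd ℂ) (ω (star B * (1 * A))) = ω (star A * (1 * B)) at h
  simpa using h

theorem gnsNorm_add_le (A B : R) : gnsNorm ω (A + B) ≤ gnsNorm ω A + gnsNorm ω B := by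
  refine le_of_sq_le_sq ?_ (add_nonneg (gnsNorm_nonneg _) (gnsNorm_nonneg _))
  have h1 := (Complex.re_le_norm _).trans (norm_apply_star_mul_le hω A B)
  have h2 := (Complex.re_le_norm _).trans (norm_apply_star_mul_le hω B A)
  have h : (ω (star (A + B) * (A + B))).re = (ω (star A * A)).re + (ω (star A * B)).re
      + ((ω (star B * A)).re + (ω (star B * B)).re) := by
    simp [mul_add, add_mul]
    ring
  rw [gnsNorm_sq hω, h, ← gnsNorm_sq hω, ← gnsNorm_sq hω]
  nlinarith

theorem gnsNorm_smul (r : ℂ) (A : R) : gnsNorm ω (r • A) = ‖r‖ * gnsNorm ω A := by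
  have h : gnsNorm ω (r • A) ^ 2 = (‖r‖ * gnsNorm ω A) ^ 2 := by
    rw [gnsNorm_sq hω, mul_pow, gnsNorm_sq hω]
    have h0 := (Complex.nonneg_iff.1 (hω A)).2
    simp [← h0, Complex.sq_norm, Complex.normSq_apply]
    ring
  exact (sq_eq_sq₀ (gnsNorm_nonneg _) (mul_nonneg (norm_nonneg _) (gnsNorm_nonneg _))).1 h

theorem gnsNorm_sum_le {κ : Type*} (s : Finset κ) (f : κ → R) :
    gnsNorm ω (∑ i ∈ s, f i) ≤ ∑ i ∈ s, gnsNorm ω (f i) := by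
  classical
  induction s using Finset.induction_on with
  | empty => simp [gnsNorm]
  | insert a s ha ih =>
    rw [Finset.sum_insert ha, Finset.sum_insert ha]
    exact (gnsNorm_add_le hω _ _).trans (by gcongr)

end

theorem gnsNorm_isometry {U : R} (hU : star U * U = 1) (A : R) :
    gnsNorm ω (U * A) = gnsNorm ω A := by
  unfold gnsNorm
  rw [star_mul, mul_assoc, ← mul_assoc (star U), hU, one_mul]

theorem apply_projection {P : R} (hP : IsStarProjection P) (A : R) :
    ω (star A * (P * A)) = ω (star (P * A) * (P * A)) := by
  rw [star_mul, hP.isSelfAdjoint.star_eq, mul_assoc, ← mul_assoc P P, hP.isIdempotentElem.eq]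

theorem gnsNorm_projection_le (hω : ∀ A : R, 0 ≤ ω (star A * A)) {P : R}
    (hP : IsStarProjection P) (A : R) : gnsNorm ω (P * A) ≤ gnsNorm ω A := by
  have h := (Complex.nonneg_iff.1 (hω ((1 - P) * A))).1
  rw [← apply_projection hP.one_sub, sub_mul, one_mul, mul_sub, map_sub, apply_projection hP,
    Complex.sub_re, ← gnsNorm_sq hω, ← gnsNorm_sq hω] at h
  exact le_of_sq_le_sq (by linarith) (gnsNorm_nonneg _)

/-- By Cauchy-Schwarz, a projection of expectation zero annihilates the GNS vector. Together with
the adjoint statement below, this is how frustration-freeness enters. -/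
theorem apply_mul_eq_zero (hω : ∀ A : R, 0 ≤ ω (star A * A)) {P : R}
    (hP : IsStarProjection P) (h0 : ω P = 0) (A : R) : ω (A * P) = 0 := by
  have h : gnsNorm ω P = 0 := by
    simp [gnsNorm, hP.isSelfAdjoint.star_eq, hP.isIdempotentElem.eq, h0]
  have h' := norm_apply_star_mul_le hω (star A) P
  rw [h, mul_zero, star_star] at h'
  exact norm_le_zero_iff.1 h'

theorem apply_mul_eq_zero' (hω : ∀ A : R, 0 ≤ ω (star A * A)) {P : R}
    (hP : IsStarProjection P) (h0 : ω P = 0) (A : R) : ω (P * A) = 0 := by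
  have h := apply_star_mul_comm hω P A
  rw [apply_mul_eq_zero hω hP h0, hP.isSelfAdjoint.star_eq, map_zero] at h
  exact h.symm

end Functional

/-! ### The Pauli algebra of the chain -/

section Pauli

variable {R : Type*} [Ring R] [StarRing R] [Algebra ℂ R] [StarModule ℂ R]

/-- The relations between the Pauli matrices `Z x = σ³ₓ` and `X x = σ¹ₓ` of a chain. -/
structure IsPauli (Z X : ℤ → R) : Prop where
  Z_sq : ∀ x, Z x * Z x = 1
  X_sq : ∀ x, X x * X x = 1
  anticomm : ∀ x, X x * Z x = -(Z x * X x)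
  Z_comm : ∀ x y, Z x * Z y = Z y * Z x
  X_comm : ∀ x y, X x * X y = X y * X x
  X_Z_comm : ∀ x y, x ≠ y → X x * Z y = Z y * X x
  star_Z : ∀ x, star (Z x) = Z x
  star_X : ∀ x, star (X x) = X x

/-- The projection onto the configurations with a domain wall between `n` and `n + 1`. -/
noncomputable def wall (Z : ℤ → R) (n : ℤ) : R := (1 / 2 : ℂ) • (1 - Z n * Z (n + 1))

/-- The interaction of `n` and `n + 1`, shifted by a constant to have ground state energy zero. -/
noncomputable def bond (t c : ℝ) (Z X : ℤ → R) (n : ℤ) : R :=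
  (1 / 2 : ℂ) • wall Z n + (t / 2 : ℂ) • (Z n * wall Z n) - (c : ℂ) • (X n * X (n + 1) * wall Z n)

variable {Z X : ℤ → R} (h : IsPauli Z X) {t c : ℝ}
include h

theorem IsPauli.Z_wall_comm (x n : ℤ) : Z x * wall Z n = wall Z n * Z x := by
  simp only [wall, mul_smul_comm, smul_mul_assoc, mul_sub, sub_mul, mul_one, one_mul]
  rw [← mul_assoc, h.Z_comm x n, mul_assoc, h.Z_comm x (n + 1), mul_assoc]

theorem IsPauli.X_wall_comm {x n : ℤ} (h1 : x ≠ n) (h2 : x ≠ n + 1) :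
    X x * wall Z n = wall Z n * X x := by
  simp only [wall, mul_smul_comm, smul_mul_assoc, mul_sub, sub_mul, mul_one, one_mul]
  rw [← mul_assoc, h.X_Z_comm x n h1, mul_assoc, h.X_Z_comm x (n + 1) h2, mul_assoc]

theorem IsPauli.X_wall_left (n : ℤ) : X n * wall Z n = (1 - wall Z n) * X n := by
  simp only [wall, mul_smul_comm, smul_mul_assoc, mul_sub, sub_mul, mul_one, one_mul]
  rw [← mul_assoc, h.anticomm, neg_mul, mul_assoc, h.X_Z_comm n (n + 1) (by omega), mul_assoc]
  module

theorem IsPauli.X_wall_right (n : ℤ) :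
    X (n + 1) * wall Z n = (1 - wall Z n) * X (n + 1) := by
  simp only [wall, mul_smul_comm, smul_mul_assoc, mul_sub, sub_mul, mul_one, one_mul]
  rw [← mul_assoc, h.X_Z_comm (n + 1) n (by omega), mul_assoc, h.anticomm, mul_neg, mul_assoc]
  module

theorem IsPauli.isStarProjection_wall (n : ℤ) : IsStarProjection (wall Z n) where
  isIdempotentElem := by
    have e : Z n * (Z (n + 1) * (Z n * Z (n + 1))) = 1 := by
      rw [h.Z_comm n (n + 1), ← mul_assoc (Z (n + 1)), h.Z_sq, one_mul, h.Z_sq]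
    simp only [IsIdempotentElem, wall, mul_smul_comm, smul_mul_assoc, mul_sub, sub_mul, mul_one,
      one_mul, mul_assoc, e]
    module
  isSelfAdjoint := by
    simp [IsSelfAdjoint, wall, h.star_Z, h.Z_comm (n + 1) n]

theorem IsPauli.wall_mul_wall (n : ℤ) : wall Z n * wall Z n = wall Z n :=
  (h.isStarProjection_wall n).isIdempotentElem

theorem IsPauli.flip_wall_comm (n : ℤ) :
    X n * X (n + 1) * wall Z n = wall Z n * (X n * X (n + 1)) := by
  rw [mul_assoc, h.X_wall_right, ← mul_assoc, mul_sub, mul_one, h.X_wall_left]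
  noncomm_ring

theorem IsPauli.flip_sq (n : ℤ) : X n * X (n + 1) * (X n * X (n + 1)) = 1 := by
  rw [h.X_comm n (n + 1), mul_assoc, h.X_comm (n + 1) n, ← mul_assoc (X n), h.X_sq, one_mul,
    h.X_sq]

theorem IsPauli.flip_Z_anticomm (n : ℤ) :
    X n * X (n + 1) * Z n = -(Z n * (X n * X (n + 1))) := by
  rw [mul_assoc, h.X_Z_comm (n + 1) n (by omega), ← mul_assoc, h.anticomm, neg_mul, mul_assoc]

theorem IsPauli.Z_wall (n : ℤ) : Z n * wall Z n = (1 / 2 : ℂ) • (Z n - Z (n + 1)) := by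
  simp only [wall, mul_smul_comm, mul_sub, mul_one]
  rw [← mul_assoc, h.Z_sq, one_mul]

theorem IsPauli.Z_succ_wall (n : ℤ) : Z (n + 1) * wall Z n = -(Z n * wall Z n) := by
  rw [h.Z_wall]
  simp only [wall, mul_smul_comm, mul_sub, mul_one]
  rw [h.Z_comm n (n + 1), ← mul_assoc, h.Z_sq, one_mul]
  module

theorem IsPauli.wall_mul_bond (n : ℤ) : wall Z n * bond t c Z X n = bond t c Z X n := by
  simp only [bond, mul_add, mul_sub, mul_smul_comm]
  rw [h.wall_mul_wall, ← mul_assoc, ← h.Z_wall_comm, mul_assoc, h.wall_mul_wall, ← mul_assoc,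
    ← h.flip_wall_comm, mul_assoc, h.wall_mul_wall]

theorem IsPauli.bond_mul_wall (n : ℤ) : bond t c Z X n * wall Z n = bond t c Z X n := by
  simp only [bond, add_mul, sub_mul, smul_mul_assoc, mul_assoc, h.wall_mul_wall]

theorem IsPauli.star_bond (n : ℤ) : star (bond t c Z X n) = bond t c Z X n := by
  have hw := (h.isStarProjection_wall n).isSelfAdjoint.star_eq
  simp only [bond, star_sub, star_add, star_smul, star_mul, hw, h.star_Z, h.star_X]
  rw [h.Z_wall_comm, h.flip_wall_comm, h.X_comm (n + 1) n]
  simp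

/-- The flip term anticommutes with `Z n` and cancels, so only the diagonal part survives. In a
state annihilated by the bond the left side has expectation zero, which ties the change of
magnetization across the bond to the wall probability. -/
theorem IsPauli.bond_Z_anticomm (n : ℤ) :
    bond t c Z X n * Z n + Z n * bond t c Z X n = Z n * wall Z n + (t : ℂ) • wall Z n := by
  have e1 : Z n * (Z n * wall Z n) = wall Z n := by rw [← mul_assoc, h.Z_sq, one_mul]
  have e2 : Z n * wall Z n * Z n = wall Z n := by rw [mul_assoc, ← h.Z_wall_comm, e1]
  have e3 : X n * X (n + 1) * wall Z n * Z n = -(Z n * (X n * X (n + 1) * wall Z n)) := by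
    rw [mul_assoc, ← h.Z_wall_comm, ← mul_assoc, h.flip_Z_anticomm, neg_mul, mul_assoc]
  simp only [bond, add_mul, sub_mul, mul_add, mul_sub, smul_mul_assoc, mul_smul_comm, e1, e2, e3,
    ← h.Z_wall_comm]
  module

/-- On antiparallel pairs the bond has diagonal entries `(1 ± t)/2` and off-diagonal entries `-c`:
trace one, and determinant `(1 - t²)/4 - c² = 0`. -/
theorem IsPauli.isIdempotentElem_bond (htc : t ^ 2 + 4 * c ^ 2 = 1) (n : ℤ) :
    IsIdempotentElem (bond t c Z X n) := by
  have htc' : (t : ℂ) ^ 2 + 4 * (c : ℂ) ^ 2 = 1 := by exact_mod_cast htc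
  set W := wall Z n with hW
  set F := X n * X (n + 1) with hF
  have w := h.wall_mul_wall n
  have f := h.flip_wall_comm n
  have ff := h.flip_sq n
  have fz := h.flip_Z_anticomm n
  have zw := h.Z_wall_comm n n
  have zz := h.Z_sq n
  rw [← hW] at w f zw
  rw [← hF] at f ff fz
  have e1 : W * (Z n * W) = Z n * W := by rw [← mul_assoc, ← zw, mul_assoc, w]
  have e2 : W * (F * W) = F * W := by rw [← mul_assoc, ← f, mul_assoc, w]
  have e3 : Z n * (Z n * W) = W := by rw [← mul_assoc, zz, one_mul]
  have e4 : F * (F * W) = W := by rw [← mul_assoc, ff, one_mul]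
  have e5 : F * (Z n * W) = -(Z n * (F * W)) := by rw [← mul_assoc, fz, neg_mul, mul_assoc]
  simp only [IsIdempotentElem, bond, ← hW, ← hF, add_mul, sub_mul, mul_add, mul_sub,
    smul_mul_assoc, mul_smul_comm, mul_assoc, w, e1, e2, e3, e4, e5]
  have hc : (c : ℂ) * c = (1 - (t : ℂ) ^ 2) / 4 := by linear_combination htc' / 4
  simp only [smul_smul, smul_add, smul_sub, hc]
  module

theorem IsPauli.isStarProjection_bond (htc : t ^ 2 + 4 * c ^ 2 = 1) (n : ℤ) :
    IsStarProjection (bond t c Z X n) :=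
  ⟨h.isIdempotentElem_bond htc n, h.star_bond n⟩

theorem IsPauli.bond_eq (n : ℤ) : bond t c Z X n = (1 / 4 : ℂ) • (1 - Z n * Z (n + 1))
    + (t / 4 : ℂ) • (Z n - Z (n + 1)) - (c / 2 : ℂ) • (X n * X (n + 1) * (1 - Z n * Z (n + 1))) := by
  rw [bond, h.Z_wall, wall]
  simp only [mul_smul_comm]
  module

/-- Elements commuting with the spins at `n` and `n + 1` commute with `bond n`. -/
theorem bond_commute {A : R} {n : ℤ} (h1 : Commute (Z n) A) (h2 : Commute (Z (n + 1)) A)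
    (h3 : Commute (X n) A) (h4 : Commute (X (n + 1)) A) : Commute (bond t c Z X n) A := by
  have hw : Commute (wall Z n) A := ((Commute.one_left A).sub_left (h1.mul_left h2)).smul_left _
  exact ((hw.smul_left _).add_left ((h1.mul_left hw).smul_left _)).sub_left
    (((h3.mul_left h4).mul_left hw).smul_left _)

theorem IsPauli.bond_commute_X {x n : ℤ} (h1 : x ≠ n) (h2 : x ≠ n + 1) :
    Commute (bond t c Z X n) (X x) :=
  bond_commute h (h.X_Z_comm x n h1).symm (h.X_Z_comm x (n + 1) h2).symm (h.X_comm _ _)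
    (h.X_comm _ _)

theorem IsPauli.bond_commute_Z {x n : ℤ} (h1 : x ≠ n) (h2 : x ≠ n + 1) :
    Commute (bond t c Z X n) (Z x) :=
  bond_commute h (h.Z_comm _ _) (h.Z_comm _ _) (h.X_Z_comm n x h1.symm)
    (h.X_Z_comm (n + 1) x h2.symm)

theorem IsPauli.bond_commute_bond {m n : ℤ} (h1 : m ≠ n) (h2 : m ≠ n + 1) (h3 : n ≠ m + 1) :
    Commute (bond t c Z X m) (bond t c Z X n) :=
  bond_commute h (h.bond_commute_Z h1 h2).symm (h.bond_commute_Z (by omega) (by omega)).symm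
    (h.bond_commute_X h1 h2).symm (h.bond_commute_X (by omega) (by omega)).symm

/-- As a two-site matrix the bond has rank one, so compression by it gives a multiple of it; `t` is
the expectation of `Z n` in its range. -/
theorem IsPauli.bond_Z_bond (htc : t ^ 2 + 4 * c ^ 2 = 1) (n : ℤ) :
    bond t c Z X n * Z n * bond t c Z X n = (t : ℂ) • bond t c Z X n := by
  have e := h.bond_Z_anticomm (t := t) (c := c) n
  have e' : bond t c Z X n * Z n =
    Z n * wall Z n + (t : ℂ) • wall Z n - Z n * bond t c Z X n := by rw [← e]; abel
  rw [e', sub_mul, add_mul, smul_mul_assoc, mul_assoc, h.wall_mul_bond, mul_assoc,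
    (h.isIdempotentElem_bond htc n).eq]
  abel

theorem IsPauli.bond_Z_succ_bond (htc : t ^ 2 + 4 * c ^ 2 = 1) (n : ℤ) :
    bond t c Z X n * Z (n + 1) * bond t c Z X n = -((t : ℂ) • bond t c Z X n) := by
  rw [← h.bond_Z_bond htc, ← h.wall_mul_bond, mul_assoc, ← mul_assoc (Z (n + 1)), h.Z_succ_wall,
    neg_mul, mul_neg, mul_assoc (Z n), h.wall_mul_bond, mul_assoc]

/-- An element changing the parity of the walls at `n` is off-diagonal for `bond n`. -/
theorem IsPauli.bond_mul_bond_eq_zero {A : R} {n : ℤ} (hA : A * wall Z n = (1 - wall Z n) * A) :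
    bond t c Z X n * A * bond t c Z X n = 0 := by
  have e : wall Z n * (A * wall Z n) = 0 := by
    rw [hA, ← mul_assoc, mul_sub, mul_one, h.wall_mul_wall, sub_self, zero_mul]
  calc bond t c Z X n * A * bond t c Z X n
      = bond t c Z X n * wall Z n * A * (wall Z n * bond t c Z X n) := by
        rw [h.wall_mul_bond, h.bond_mul_wall]
    _ = bond t c Z X n * (wall Z n * (A * wall Z n)) * bond t c Z X n := by
        simp only [mul_assoc]
    _ = 0 := by rw [e, mul_zero, zero_mul]

/-- The Temperley-Lieb relation. -/
theorem IsPauli.bond_bond_succ_bond (htc : t ^ 2 + 4 * c ^ 2 = 1) (n : ℤ) :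
    bond t c Z X n * bond t c Z X (n + 1) * bond t c Z X n = (c : ℂ) ^ 2 • bond t c Z X n := by
  have htc' : (t : ℂ) ^ 2 + 4 * (c : ℂ) ^ 2 = 1 := by exact_mod_cast htc
  have hP := (h.isIdempotentElem_bond htc n).eq
  have cZ := (h.bond_commute_Z (t := t) (c := c) (x := n + 1 + 1) (n := n) (by omega) (by omega)).eq
  have cX := (h.bond_commute_X (t := t) (c := c) (x := n + 1 + 1) (n := n) (by omega) (by omega)).eq
  have e1 := h.bond_Z_succ_bond htc n
  have e2 : bond t c Z X n * X (n + 1) * bond t c Z X n = 0 :=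
    h.bond_mul_bond_eq_zero (h.X_wall_right n)
  have e3 : bond t c Z X n * (X (n + 1) * Z (n + 1)) * bond t c Z X n = 0 := by
    refine h.bond_mul_bond_eq_zero ?_
    rw [mul_assoc, h.Z_wall_comm, ← mul_assoc, h.X_wall_right, mul_assoc]
  have e4 : X (n + 1 + 1) * (Z (n + 1) * Z (n + 1 + 1)) =
      Z (n + 1) * (X (n + 1 + 1) * Z (n + 1 + 1)) := by
    rw [← mul_assoc, h.X_Z_comm _ _ (by omega), mul_assoc]
  -- Expand the middle bond in Pauli monomials. Factors at site `n + 2` commute with `P`; those at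
  -- `n + 1` are compressed, `Z` to `-t` and `X`, `XZ` to zero. The terms in `Z (n + 2)` cancel,
  -- leaving `(1 - t²)/4 = c²`.
  rw [h.bond_eq (n + 1)]
  set P := bond t c Z X n
  simp only [mul_add, add_mul, mul_sub, sub_mul, mul_smul_comm, smul_mul_assoc, mul_one]
  have f1 : P * (Z (n + 1) * Z (n + 1 + 1)) * P = -((t : ℂ) • (P * Z (n + 1 + 1))) := by
    rw [mul_assoc, mul_assoc, ← cZ, ← mul_assoc, ← mul_assoc, e1, neg_mul, smul_mul_assoc]
  have f2 : P * Z (n + 1 + 1) * P = P * Z (n + 1 + 1) := by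
    rw [mul_assoc, ← cZ, ← mul_assoc, hP]
  have f3 : P * (X (n + 1) * X (n + 1 + 1)) * P = 0 := by
    rw [mul_assoc, mul_assoc, ← cX, ← mul_assoc, ← mul_assoc, e2, zero_mul]
  have f4 : P * (X (n + 1) * X (n + 1 + 1) * (Z (n + 1) * Z (n + 1 + 1))) * P = 0 := by
    rw [mul_assoc (X (n + 1)), e4, ← mul_assoc (X (n + 1)), mul_assoc, mul_assoc,
      mul_assoc (X (n + 1 + 1)), ← cZ, ← mul_assoc (X (n + 1 + 1)), ← cX, mul_assoc P,
      ← mul_assoc _ P, ← mul_assoc P, ← mul_assoc P, e3, zero_mul]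
  rw [hP, f1, e1, f2, f3, f4]
  have hc : (c : ℂ) ^ 2 = (1 - (t : ℂ) ^ 2) / 4 := by linear_combination htc' / 4
  rw [hc]
  module

/-- Moving the flip to the left turns `wall` into `1 - wall`. Deviations from free hopping thus
appear as walls on the far right, next to the GNS vector, where they are small. -/
theorem IsPauli.bond_mul_X (n : ℤ) : bond t c Z X n * X n =
    (1 / 2 : ℂ) • (X n * (1 - wall Z n)) - (t / 2 : ℂ) • (X n * (Z n * (1 - wall Z n)))
      - (c : ℂ) • (X (n + 1) * (1 - wall Z n)) := by
  have e : wall Z n * X n = X n * (1 - wall Z n) := by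
    rw [mul_sub, mul_one, h.X_wall_left]
    noncomm_ring
  have f : Z n * X n = -(X n * Z n) := by rw [h.anticomm, neg_neg]
  have g : X n * X (n + 1) * X n = X (n + 1) := by
    rw [mul_assoc, h.X_comm (n + 1), ← mul_assoc, h.X_sq, one_mul]
  simp only [bond, add_mul, sub_mul, smul_mul_assoc]
  rw [mul_assoc (Z n), mul_assoc _ (wall Z n), e, ← mul_assoc (Z n), f, ← mul_assoc _ (X n), g,
    neg_mul, mul_assoc (X n)]
  module

theorem IsPauli.bond_mul_X_succ (n : ℤ) : bond t c Z X n * X (n + 1) =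
    (1 / 2 : ℂ) • (X (n + 1) * (1 - wall Z n))
      + (t / 2 : ℂ) • (X (n + 1) * (Z n * (1 - wall Z n))) - (c : ℂ) • (X n * (1 - wall Z n)) := by
  have e : wall Z n * X (n + 1) = X (n + 1) * (1 - wall Z n) := by
    rw [mul_sub, mul_one, h.X_wall_right]
    noncomm_ring
  have f : Z n * X (n + 1) = X (n + 1) * Z n := (h.X_Z_comm (n + 1) n (by omega)).symm
  have g : X n * X (n + 1) * X (n + 1) = X n := by rw [mul_assoc, h.X_sq, mul_one]
  simp only [bond, add_mul, sub_mul, smul_mul_assoc]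
  rw [mul_assoc (Z n), mul_assoc _ (wall Z n), e, ← mul_assoc (Z n), f, ← mul_assoc _ (X (n + 1)),
    g, mul_assoc (X (n + 1))]

/-- Away from domain walls a flipped spin hops like a free particle. -/
theorem IsPauli.bond_add_bond_mul_X (n : ℤ) :
    (bond t c Z X n + bond t c Z X (n + 1)) * X (n + 1) -
      (X (n + 1) - (c : ℂ) • X n - (c : ℂ) • X (n + 1 + 1)) =
    ((-1 / 2 : ℂ) • (X (n + 1) * wall Z n) + (c : ℂ) • (X n * wall Z n)
      + (t / 2 : ℂ) • (X (n + 1) * (Z n * wall Z n)))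
    + ((-1 / 2 : ℂ) • (X (n + 1) * wall Z (n + 1)) + (c : ℂ) • (X (n + 1 + 1) * wall Z (n + 1))
      + (t / 2 : ℂ) • (X (n + 1) * (Z (n + 1) * wall Z (n + 1)))) := by
  rw [add_mul, h.bond_mul_X, h.bond_mul_X_succ]
  simp only [mul_sub, mul_one, h.Z_wall, mul_smul_comm]
  module

end Pauli

/-! ### Frustration-free states -/

section FrustrationFree

variable {R : Type*} [Ring R] [StarRing R] [Algebra ℂ R] [StarModule ℂ R]

/-- The sum of the interactions of the bonds `(n, n + 1)`, `n ∈ F`. -/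
noncomputable def bondSum (t c : ℝ) (Z X : ℤ → R) (F : Finset ℤ) : R :=
  ∑ n ∈ F, bond t c Z X n

variable {Z X : ℤ → R} {t c : ℝ} {ω : R →ₗ[ℂ] ℂ}

theorem IsPauli.star_bondSum (h : IsPauli Z X) (F : Finset ℤ) :
    star (bondSum t c Z X F) = bondSum t c Z X F := by
  simp [bondSum, h.star_bond]

variable (h : IsPauli Z X) (htc : t ^ 2 + 4 * c ^ 2 = 1) (hω : ∀ A : R, 0 ≤ ω (star A * A))
include h htc hω

theorem apply_bondSum (F : Finset ℤ) (A : R) : ω (star A * (bondSum t c Z X F * A)) =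
    ((∑ n ∈ F, gnsNorm ω (bond t c Z X n * A) ^ 2 : ℝ) : ℂ) := by
  rw [bondSum, Finset.sum_mul, Finset.mul_sum, map_sum, Complex.ofReal_sum]
  refine Finset.sum_congr rfl fun n _ => ?_
  rw [apply_projection (h.isStarProjection_bond htc n), apply_star_mul_self hω]

theorem apply_bondSum_nonneg (F : Finset ℤ) (A : R) :
    0 ≤ ω (star A * (bondSum t c Z X F * A)) := by
  rw [apply_bondSum h htc hω]
  exact Complex.zero_le_real.2 (Finset.sum_nonneg fun _ _ => sq_nonneg _)

theorem gnsNorm_bondSum_mul_le (F : Finset ℤ) (A : R) :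
    gnsNorm ω (bondSum t c Z X F * A) ≤ F.card * gnsNorm ω A := by
  rw [bondSum, Finset.sum_mul]
  refine (gnsNorm_sum_le hω _ _).trans ?_
  rw [← nsmul_eq_mul]
  exact Finset.sum_le_card_nsmul _ _ _ fun n _ =>
    gnsNorm_projection_le hω (h.isStarProjection_bond htc n) A

/-- For the two projections `P`, `Q`, Temperley-Lieb gives `‖QPA‖ = c ‖PA‖`. Cauchy-Schwarz for
`QPA` and `QA` and the inequality `2ab ≤ a² + b²` finish. -/
theorem norm_apply_bond_bond_succ_le (hc : 0 ≤ c) (n : ℤ) (A : R) :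
    ‖ω (star (bond t c Z X n * A) * (bond t c Z X (n + 1) * A))‖ ≤
      c / 2 * (gnsNorm ω (bond t c Z X n * A) ^ 2 + gnsNorm ω (bond t c Z X (n + 1) * A) ^ 2) := by
  set P := bond t c Z X n with hP
  set Q := bond t c Z X (n + 1) with hQ
  have hQp : IsStarProjection Q := h.isStarProjection_bond htc (n + 1)
  have hPp : IsStarProjection P := h.isStarProjection_bond htc n
  have e1 : star (P * A) * (Q * A) = star (Q * (P * A)) * (Q * A) := by
    rw [star_mul Q, hQp.isSelfAdjoint.star_eq, mul_assoc _ Q, ← mul_assoc Q Q,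
      hQp.isIdempotentElem.eq]
  have e2 : gnsNorm ω (Q * (P * A)) = c * gnsNorm ω (P * A) := by
    have : gnsNorm ω (Q * (P * A)) ^ 2 = (c * gnsNorm ω (P * A)) ^ 2 := by
      rw [gnsNorm_sq hω, mul_pow, gnsNorm_sq hω, ← apply_projection hQp,
        ← apply_projection hPp, star_mul P, hPp.isSelfAdjoint.star_eq, mul_assoc, ← mul_assoc Q,
        ← mul_assoc P, ← mul_assoc P, h.bond_bond_succ_bond htc, smul_mul_assoc, mul_smul_comm,
        map_smul, ← Complex.ofReal_pow, smul_eq_mul, Complex.re_ofReal_mul]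
    exact (sq_eq_sq₀ (gnsNorm_nonneg _) (mul_nonneg hc (gnsNorm_nonneg _))).1 this
  rw [e1]
  refine (norm_apply_star_mul_le hω _ _).trans ?_
  rw [e2]
  nlinarith [mul_nonneg hc (sq_nonneg (gnsNorm ω (P * A) - gnsNorm ω (Q * A)))]

/-- Neighbouring bonds lose at most the Temperley-Lieb estimate; distant ones commute, so their
product is a projection and contributes nonnegatively. The indicators put all cases in one bound
that can be summed over pairs. -/
theorem re_apply_bond_bond_ge (hc : 0 ≤ c) (m n : ℤ) (A : R) :
    (if m = n then gnsNorm ω (bond t c Z X n * A) ^ 2 else 0)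
      - c / 2 * ((if m = n + 1 then gnsNorm ω (bond t c Z X n * A) ^ 2 else 0)
        + (if m = n + 1 then gnsNorm ω (bond t c Z X m * A) ^ 2 else 0)
        + (if n = m + 1 then gnsNorm ω (bond t c Z X n * A) ^ 2 else 0)
        + (if n = m + 1 then gnsNorm ω (bond t c Z X m * A) ^ 2 else 0)) ≤
    (ω (star (bond t c Z X n * A) * (bond t c Z X m * A))).re := by
  by_cases h1 : m = n
  · subst h1
    simp [gnsNorm_sq hω]
  by_cases h2 : m = n + 1
  · subst h2
    have := norm_apply_bond_bond_succ_le h htc hω hc n A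
    have h' := (abs_le.1 (Complex.abs_re_le_norm _)).1.trans' (neg_le_neg this)
    have h4 : ¬n = n + 1 + 1 := by omega
    simp only [h1, h4, if_true, if_false]
    linarith
  by_cases h3 : n = m + 1
  · subst h3
    have := norm_apply_bond_bond_succ_le h htc hω hc m A
    have h' := (abs_le.1 (Complex.abs_re_le_norm _)).1.trans' (neg_le_neg this)
    rw [← apply_star_mul_comm hω, Complex.conj_re]
    simp only [h1, h2, if_true, if_false]
    linarith
  · simp only [h1, h2, h3, if_false]
    have hcomm := h.bond_commute_bond (t := t) (c := c) h1 h2 h3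
    have hm := h.isStarProjection_bond htc m
    have hn := h.isStarProjection_bond htc n
    have e : star (bond t c Z X n * A) * (bond t c Z X m * A) =
        star A * (bond t c Z X n * bond t c Z X m * A) := by
      rw [star_mul, hn.isSelfAdjoint.star_eq]
      simp only [mul_assoc]
    rw [e, apply_projection (hn.mul hm hcomm.symm)]
    simp only [add_zero, mul_zero, sub_zero]
    exact (Complex.nonneg_iff.1 (hω _)).1

/-- Expand `H²` over pairs of bonds. Each bond has at most one neighbour on either side, so each of
the four neighbour sums is at most `∑ ‖P_n A‖²`, and the total loss is the fraction `4 · c/2 = 2c`.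
-/
theorem bondSum_sq_ge (hc : 0 ≤ c) (F : Finset ℤ) (A : R) :
    (1 - 2 * c) * (ω (star A * (bondSum t c Z X F * A))).re ≤
      gnsNorm ω (bondSum t c Z X F * A) ^ 2 := by
  rw [gnsNorm_sq hω, apply_bondSum h htc hω, Complex.ofReal_re]
  set a : ℤ → ℝ := fun n => gnsNorm ω (bond t c Z X n * A) ^ 2 with ha
  have ha0 : ∀ n, 0 ≤ a n := fun n => sq_nonneg _
  have e : (ω (star (bondSum t c Z X F * A) * (bondSum t c Z X F * A))).re =
      ∑ n ∈ F, ∑ m ∈ F, (ω (star (bond t c Z X n * A) * (bond t c Z X m * A))).re := by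
    simp only [bondSum, Finset.sum_mul, star_sum, Finset.mul_sum, map_sum, Complex.re_sum]
    exact Finset.sum_comm
  have s1 : ∑ n ∈ F, ∑ m ∈ F, (if m = n then a n else 0) = ∑ n ∈ F, a n :=
    Finset.sum_congr rfl fun n hn => by simp [hn]
  have key : ∀ p : ℤ → ℤ, ∑ n ∈ F, ∑ m ∈ F, (if m = p n then a n else 0) ≤ ∑ n ∈ F, a n := by
    refine fun p => Finset.sum_le_sum fun n _ => ?_
    rw [Finset.sum_ite_eq']
    split_ifs
    · exact le_rfl
    · exact ha0 n
  have hp : ∀ m n : ℤ, m = n + 1 ↔ n = m - 1 := fun m n => by omega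
  have s2 := key (fun n => n + 1)
  have s3 : ∑ n ∈ F, ∑ m ∈ F, (if m = n + 1 then a m else 0) ≤ ∑ n ∈ F, a n := by
    rw [Finset.sum_comm]
    simp only [hp]
    exact key (fun n => n - 1)
  have s4 : ∑ n ∈ F, ∑ m ∈ F, (if n = m + 1 then a n else 0) ≤ ∑ n ∈ F, a n := by
    simp only [hp]
    exact key (fun n => n - 1)
  have s5 : ∑ n ∈ F, ∑ m ∈ F, (if n = m + 1 then a m else 0) ≤ ∑ n ∈ F, a n := by
    rw [Finset.sum_comm]
    exact s2
  have := Finset.sum_le_sum fun n (_ : n ∈ F) => Finset.sum_le_sum fun m (_ : m ∈ F) =>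
    re_apply_bond_bond_ge h htc hω hc m n A
  rw [← e] at this
  refine le_trans ?_ this
  simp only [Finset.sum_sub_distrib, ← Finset.mul_sum, Finset.sum_add_distrib]
  simp only [ha] at s1 s2 s3 s4 s5
  rw [s1]
  nlinarith

/-- Let `x = ⟨A, HA⟩`, `y = ‖HA‖²`, `z = ⟨HA, H(HA)⟩`. Cauchy-Schwarz for the form of `H` reads `y²
≤ xz`, and `(1 - 2c) x ≤ y`; so `(1 - 2c) y² ≤ yz`. This replaces inserting a square root of `H`. -/
theorem bondSum_cube_ge (hc : 0 ≤ c) (hc' : 2 * c ≤ 1) (F : Finset ℤ) (A : R) :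
    (1 - 2 * c) * gnsNorm ω (bondSum t c Z X F * A) ^ 2 ≤
      (ω (star (bondSum t c Z X F * A) * (bondSum t c Z X F * (bondSum t c Z X F * A)))).re := by
  have h1 := bondSum_sq_ge h htc hω hc F A
  set H := bondSum t c Z X F
  have h2 := norm_form_sq_le ω H (apply_bondSum_nonneg h htc hω F) A (H * A)
  have e : star A * (H * (H * A)) = star (H * A) * (H * A) := by
    rw [star_mul, h.star_bondSum, mul_assoc]
  have hz := (Complex.nonneg_iff.1 (apply_bondSum_nonneg h htc hω F (H * A))).1
  rw [e, apply_star_mul_self hω, Complex.norm_real, Real.norm_eq_abs, sq_abs] at h2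
  set y := gnsNorm ω (H * A) ^ 2
  have hy : 0 ≤ y := sq_nonneg _
  rcases hy.eq_or_lt with hy | hy
  · rw [← hy, mul_zero]
    exact hz
  · refine le_of_mul_le_mul_left ?_ hy
    nlinarith [mul_le_mul_of_nonneg_right h1 hz,
      mul_le_mul_of_nonneg_left h2 (by linarith : 0 ≤ 1 - 2 * c)]

section

variable (h0 : ∀ n, ω (bond t c Z X n) = 0)
include h0

theorem apply_mul_bondSum (F : Finset ℤ) (A : R) : ω (A * bondSum t c Z X F) = 0 := by
  rw [bondSum, Finset.mul_sum, map_sum]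
  exact Finset.sum_eq_zero fun n _ =>
    apply_mul_eq_zero hω (h.isStarProjection_bond htc n) (h0 n) A

theorem apply_bondSum_mul (F : Finset ℤ) (A : R) : ω (bondSum t c Z X F * A) = 0 := by
  rw [bondSum, Finset.sum_mul, map_sum]
  exact Finset.sum_eq_zero fun n _ =>
    apply_mul_eq_zero' hω (h.isStarProjection_bond htc n) (h0 n) A

/-- `H` annihilates the state from both sides, so under `ω` commutators with `H` reduce to left
multiplication by `H`. -/
theorem apply_mul_commutator (F : Finset ℤ) (A B : R) :
    ω (B * (bondSum t c Z X F * A - A * bondSum t c Z X F)) = ω (B * (bondSum t c Z X F * A)) := by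
  rw [mul_sub, map_sub, ← mul_assoc B A, apply_mul_bondSum h htc hω h0, sub_zero]

theorem apply_star_commutator_mul (F : Finset ℤ) (A B : R) :
    ω (star (bondSum t c Z X F * A - A * bondSum t c Z X F) * B) =
      ω (star (bondSum t c Z X F * A) * B) := by
  rw [star_sub, sub_mul, map_sub, star_mul A, h.star_bondSum, mul_assoc (bondSum t c Z X F),
    apply_bondSum_mul h htc hω h0, sub_zero]

theorem apply_star_commutator_mul_commutator (F : Finset ℤ) (A : R) :
    ω (star (bondSum t c Z X F * A - A * bondSum t c Z X F) *
        (bondSum t c Z X F * A - A * bondSum t c Z X F)) =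
      ((gnsNorm ω (bondSum t c Z X F * A) ^ 2 : ℝ) : ℂ) := by
  rw [apply_star_commutator_mul h htc hω h0, apply_mul_commutator h htc hω h0,
    apply_star_mul_self hω]

theorem apply_star_commutator_mul_commutator₂ (F : Finset ℤ) (A : R) :
    ω (star (bondSum t c Z X F * A - A * bondSum t c Z X F) *
        (bondSum t c Z X F * (bondSum t c Z X F * A - A * bondSum t c Z X F) -
          (bondSum t c Z X F * A - A * bondSum t c Z X F) * bondSum t c Z X F)) =
      ω (star (bondSum t c Z X F * A) * (bondSum t c Z X F * (bondSum t c Z X F * A))) := by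
  rw [apply_mul_commutator h htc hω h0, apply_star_commutator_mul h htc hω h0, mul_sub, mul_sub,
    map_sub, ← mul_assoc (bondSum t c Z X F) A, ← mul_assoc _ _ (bondSum t c Z X F),
    apply_mul_bondSum h htc hω h0, sub_zero]

end

end FrustrationFree

/-! ### Spin waves far from the domain walls -/

/-- The amplitudes of a hop by `-1`, `0` or `1` of a flipped spin. -/
def hopAmp (c : ℝ) (b : ℤ) : ℝ := if b = 0 then 1 else -c

/-- The symbol of the hopping at momentum zero, the energy that the trial waves approach. -/
theorem sum_hopAmp (c : ℝ) : ∑ b ∈ ({-1, 0, 1} : Finset ℤ), hopAmp c b = 1 - 2 * c := by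
  simp [hopAmp]
  ring

/-- The number of coincidences of two copies of `{0, …, N - 1}` shifted by `i` and `j`. -/
theorem tendsto_coincidences (i j : ℤ) :
    Tendsto (fun N : ℕ => (∑ k ∈ Finset.range N, ∑ k' ∈ Finset.range N,
      (if (k : ℤ) + i = k' + j then (1 : ℝ) else 0)) / N) atTop (𝓝 1) := by
  set d := (i - j).natAbs with hd
  have upper : ∀ N : ℕ, (∑ k ∈ Finset.range N, ∑ k' ∈ Finset.range N,
      (if (k : ℤ) + i = k' + j then (1 : ℝ) else 0)) ≤ N := by
    intro N
    calc _ ≤ ∑ k ∈ Finset.range N, (1 : ℝ) := by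
          refine Finset.sum_le_sum fun k _ => ?_
          rw [Finset.sum_boole]
          have : (Finset.filter (fun k' : ℕ => (k : ℤ) + i = k' + j) (Finset.range N)).card ≤ 1 :=
            Finset.card_le_one.2 fun x hx y hy => by
              simp only [Finset.mem_filter] at hx hy
              omega
          exact_mod_cast this
      _ = N := by simp
  have lower : ∀ N : ℕ, (N : ℝ) - 2 * d ≤ (∑ k ∈ Finset.range N, ∑ k' ∈ Finset.range N,
      (if (k : ℤ) + i = k' + j then (1 : ℝ) else 0)) := by
    intro N
    -- Keeping `k` at distance `d = |i - j|` from both ends ensures that `k + i - j` still lies in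
    -- `range N`.
    calc (N : ℝ) - 2 * d ≤ ∑ k ∈ Finset.Ico d (N - d), (1 : ℝ) := by
          simp only [Finset.sum_const, Nat.card_Ico, nsmul_eq_mul, mul_one]
          have : N ≤ (N - d - d) + 2 * d := by omega
          have : (N : ℝ) ≤ ((N - d - d : ℕ) : ℝ) + 2 * d := by exact_mod_cast this
          linarith
      _ ≤ ∑ k ∈ Finset.Ico d (N - d), ∑ k' ∈ Finset.range N,
          (if (k : ℤ) + i = k' + j then (1 : ℝ) else 0) := by
          refine Finset.sum_le_sum fun k hk => ?_
          rw [Finset.mem_Ico] at hk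
          rw [Finset.sum_boole]
          have : 0 < (Finset.filter (fun k' : ℕ => (k : ℤ) + i = k' + j) (Finset.range N)).card :=
            Finset.card_pos.2 ⟨((k : ℤ) + i - j).toNat, by
              simp only [Finset.mem_filter, Finset.mem_range]
              omega⟩
          exact_mod_cast this
      _ ≤ _ := by
          refine Finset.sum_le_sum_of_subset_of_nonneg ?_ fun _ _ _ =>
            Finset.sum_nonneg fun _ _ => by split_ifs <;> simp
          intro k hk
          rw [Finset.mem_Ico] at hk
          rw [Finset.mem_range]
          omega
  have hl : Tendsto (fun N : ℕ => 1 - (2 * d : ℝ) / N) atTop (𝓝 1) := by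
    simpa using (tendsto_const_nhds (x := (1 : ℝ))).sub
      (tendsto_natCast_atTop_atTop.const_div_atTop (2 * d : ℝ))
  refine tendsto_of_tendsto_of_tendsto_of_le_of_le' hl tendsto_const_nhds ?_ ?_
  · filter_upwards [eventually_gt_atTop 0] with N hN
    have hN' : (0 : ℝ) < N := by exact_mod_cast hN
    rw [le_div_iff₀ hN', sub_mul, div_mul_cancel₀ _ hN'.ne', one_mul]
    exact lower N
  · filter_upwards [eventually_gt_atTop 0] with N hN
    have hN' : (0 : ℝ) < N := by exact_mod_cast hN
    rw [div_le_one hN']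
    exact upper N

section SpinWave

variable {R : Type*} [Ring R] [StarRing R] [Algebra ℂ R] [StarModule ℂ R]
variable {Z X : ℤ → R} {t c : ℝ} {ω : R →ₗ[ℂ] ℂ}

/-- A superposition of spin flips with amplitudes `w j` at the sites `m + pos j`. -/
noncomputable def wave {J : Type*} (X : ℤ → R) (T : Finset J) (w : J → ℝ) (pos : J → ℤ) (m : ℤ) :
    R := ∑ j ∈ T, (w j : ℂ) • X (m + pos j)

/-- Allows `HA` and `H(HA)` to be replaced in expectations by explicit waves: the uniform bound on
the waves controls the cross terms. -/
theorem tendsto_apply_star_mul (hω : ∀ A : R, 0 ≤ ω (star A * A)) {A A' B B' : ℤ → R} {C : ℝ}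
    (hA : Tendsto (fun m => gnsNorm ω (A m - A' m)) atTop (𝓝 0))
    (hB : Tendsto (fun m => gnsNorm ω (B m - B' m)) atTop (𝓝 0))
    (hA' : ∀ m, gnsNorm ω (A' m) ≤ C) (hB' : ∀ m, gnsNorm ω (B' m) ≤ C) {z : ℂ}
    (hz : Tendsto (fun m => ω (star (A' m) * B' m)) atTop (𝓝 z)) :
    Tendsto (fun m => ω (star (A m) * B m)) atTop (𝓝 z) := by
  have hd : Tendsto (fun m => ω (star (A m) * B m) - ω (star (A' m) * B' m)) atTop (𝓝 0) := by
    have hb : Tendsto (fun m => C * gnsNorm ω (B m - B' m)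
        + gnsNorm ω (A m - A' m) * gnsNorm ω (B m - B' m) + gnsNorm ω (A m - A' m) * C) atTop
        (𝓝 0) := by
      simpa using ((hB.const_mul C).add (hA.mul hB)).add (hA.mul_const C)
    refine squeeze_zero_norm (fun m => ?_) hb
    have e : ω (star (A m) * B m) - ω (star (A' m) * B' m) = ω (star (A' m) * (B m - B' m))
        + ω (star (A m - A' m) * (B m - B' m)) + ω (star (A m - A' m) * B' m) := by
      rw [← map_sub, ← map_add, ← map_add]
      congr 1
      rw [star_sub]
      noncomm_ring
    rw [e]
    refine (norm_add₃_le).trans (add_le_add_three ?_ ?_ ?_)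
    · exact (norm_apply_star_mul_le hω _ _).trans
        (mul_le_mul_of_nonneg_right (hA' m) (gnsNorm_nonneg _))
    · exact norm_apply_star_mul_le hω _ _
    · exact (norm_apply_star_mul_le hω _ _).trans
        (mul_le_mul_of_nonneg_left (hB' m) (gnsNorm_nonneg _))
  simpa using hd.add hz

variable (h : IsPauli Z X) (htc : t ^ 2 + 4 * c ^ 2 = 1) (hω : ∀ A : R, 0 ≤ ω (star A * A))
  (hω1 : ω 1 = 1) (h0 : ∀ n, ω (bond t c Z X n) = 0)
include h hω

theorem IsPauli.gnsNorm_X_mul (x : ℤ) (A : R) : gnsNorm ω (X x * A) = gnsNorm ω A :=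
  gnsNorm_isometry (by rw [h.star_X, h.X_sq]) A

theorem IsPauli.gnsNorm_Z_mul (x : ℤ) (A : R) : gnsNorm ω (Z x * A) = gnsNorm ω A :=
  gnsNorm_isometry (by rw [h.star_Z, h.Z_sq]) A

include hω1 in
theorem IsPauli.gnsNorm_X (x : ℤ) : gnsNorm ω (X x) = 1 := by
  simp [gnsNorm, h.star_X, h.X_sq, hω1]

include hω1 in
theorem gnsNorm_wave_le {J : Type*} (T : Finset J) (w : J → ℝ) (pos : J → ℤ) (m : ℤ) :
    gnsNorm ω (wave X T w pos m) ≤ ∑ j ∈ T, |w j| := by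
  refine (gnsNorm_sum_le hω _ _).trans (Finset.sum_le_sum fun j _ => ?_)
  rw [gnsNorm_smul hω, h.gnsNorm_X hω hω1]
  simp

include htc hω1 h0 in
/-- The probability of a domain wall at `n` vanishes as `n → ∞`. -/
theorem tendsto_gnsNorm_wall (ht : 0 < t) :
    Tendsto (fun n => gnsNorm ω (wall Z n)) atTop (𝓝 0) := by
  have hsq : ∀ n, gnsNorm ω (wall Z n) ^ 2 = (ω (wall Z n)).re := fun n => by
    rw [gnsNorm_sq hω, (h.isStarProjection_wall n).isSelfAdjoint.star_eq, h.wall_mul_wall]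
  -- Take the expectation of `bond_Z_anticomm`; both terms with the bond vanish. The magnetization
  -- is then monotone and bounded, so its increments, which are the wall probabilities up to `2t`,
  -- tend to zero.
  have step : ∀ n, (ω (Z (n + 1))).re - (ω (Z n)).re = 2 * t * gnsNorm ω (wall Z n) ^ 2 := by
    intro n
    have e := congrArg ω (h.bond_Z_anticomm (t := t) (c := c) n)
    rw [map_add, map_add, apply_mul_eq_zero hω (h.isStarProjection_bond htc n) (h0 n),
      apply_mul_eq_zero' hω (h.isStarProjection_bond htc n) (h0 n), h.Z_wall, map_smul, map_smul,
      map_sub] at e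
    have e' := congrArg Complex.re e
    simp at e'
    rw [hsq]
    linarith
  have mono : Monotone fun n => (ω (Z n)).re := monotone_int_of_le_succ fun n => by
    have := step n
    have : 0 ≤ 2 * t * gnsNorm ω (wall Z n) ^ 2 := by positivity
    linarith
  have bdd : BddAbove (Set.range fun n => (ω (Z n)).re) := by
    refine ⟨1, ?_⟩
    rintro _ ⟨n, rfl⟩
    have := (Complex.nonneg_iff.1 (hω (1 - Z n))).1
    simp [mul_sub, sub_mul, h.star_Z, h.Z_sq, hω1] at this
    simp only
    linarith
  have lim := tendsto_atTop_ciSup mono bdd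
  have lim' := (lim.comp (tendsto_atTop_add_const_right atTop (1 : ℤ) tendsto_id)).sub lim
  rw [sub_self] at lim'
  have lim2 : Tendsto (fun n => gnsNorm ω (wall Z n) ^ 2) atTop (𝓝 0) := by
    have := lim'.div_const (2 * t)
    rw [zero_div] at this
    refine this.congr fun n => ?_
    simp only [Function.comp, id]
    rw [step]
    field_simp
  have := lim2.sqrt
  rw [Real.sqrt_zero] at this
  exact this.congr fun n => Real.sqrt_sq (gnsNorm_nonneg _)

include htc hω1 h0 in
-- Distant flips are asymptotically orthonormal. For `i < j` the site `m + i` does not meet the bond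
-- at `m + j`, so flipping both sites toggles the wall `W` there. Hence `A = AW + WA` for the
-- product `A` of the flips, and its expectation is at most `2‖W‖`.
theorem tendsto_apply_X_mul_X (ht : 0 < t) (i j : ℤ) :
    Tendsto (fun m => ω (X (m + i) * X (m + j))) atTop (𝓝 (if i = j then 1 else 0)) := by
  wlog hij : i ≤ j generalizing i j
  · have := this j i (by omega)
    simp only [h.X_comm _ (_ + i)] at this
    simpa only [eq_comm] using this
  by_cases e : i = j
  · subst e
    simp [h.X_sq, hω1]
  rw [if_neg e]
  have hw := (tendsto_gnsNorm_wall h htc hω hω1 h0 ht).comp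
    (tendsto_atTop_add_const_right atTop j tendsto_id)
  refine squeeze_zero_norm (fun m => ?_) (by simpa using hw.const_mul 2)
  set A := X (m + i) * X (m + j) with hA
  set W := wall Z (m + j) with hW
  have hWs : star W = W := (h.isStarProjection_wall (m + j)).isSelfAdjoint.star_eq
  have e1 : A = A * W + W * A := by
    have h1 : X (m + i) * W = W * X (m + i) := h.X_wall_comm (by omega) (by omega)
    have h2 : X (m + j) * W = (1 - W) * X (m + j) := h.X_wall_left (m + j)
    rw [hA, mul_assoc, h2, sub_mul, one_mul, mul_sub, ← mul_assoc, ← mul_assoc, h1]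
    abel
  have hAA : A = star A := by
    rw [hA, star_mul, h.star_X, h.star_X, h.X_comm]
  have hAn : gnsNorm ω A = 1 := by rw [hA, h.gnsNorm_X_mul hω, h.gnsNorm_X hω hω1]
  have b1 : ‖ω (A * W)‖ ≤ gnsNorm ω W := by
    have := norm_apply_star_mul_le hω A W
    rwa [← hAA, hAn, one_mul] at this
  have b2 : ‖ω (W * A)‖ ≤ gnsNorm ω W := by
    have := norm_apply_star_mul_le hω W A
    rwa [hWs, hAn, mul_one] at this
  change ‖ω A‖ ≤ 2 * gnsNorm ω W
  calc ‖ω A‖ = ‖ω (A * W) + ω (W * A)‖ := by rw [← map_add, ← e1]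
    _ ≤ 2 * gnsNorm ω W := (norm_add_le _ _).trans (by linarith)

include htc hω1 h0 in
theorem tendsto_apply_star_wave_mul_wave (ht : 0 < t) {J J' : Type*} (T : Finset J) (w : J → ℝ)
    (pos : J → ℤ) (T' : Finset J') (w' : J' → ℝ) (pos' : J' → ℤ) :
    Tendsto (fun m => ω (star (wave X T w pos m) * wave X T' w' pos' m)) atTop
      (𝓝 ((∑ j ∈ T, ∑ j' ∈ T', w j * w' j' * (if pos j = pos' j' then 1 else 0) : ℝ) : ℂ)) := by
  have e : ∀ m, ω (star (wave X T w pos m) * wave X T' w' pos' m) =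
      ∑ j ∈ T, ∑ j' ∈ T', (w j * w' j' : ℂ) * ω (X (m + pos j) * X (m + pos' j')) := by
    intro m
    simp only [wave, star_sum, star_smul, h.star_X, Finset.sum_mul, Finset.mul_sum, map_sum,
      smul_mul_assoc, mul_smul_comm, map_smul, smul_eq_mul, Complex.star_def, Complex.conj_ofReal]
    rw [Finset.sum_comm]
    refine Finset.sum_congr rfl fun j _ => Finset.sum_congr rfl fun j' _ => by ring
  simp only [e]
  push_cast
  refine tendsto_finsetSum _ fun j _ => tendsto_finsetSum _ fun j' _ => Tendsto.const_mul _ ?_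
  exact_mod_cast tendsto_apply_X_mul_X h htc hω hω1 h0 ht (pos j) (pos' j')

include htc h0 in
-- Bonds avoiding site `n + 1` commute with the flip and then annihilate the state. The two
-- remaining bonds make it hop, with errors that are walls multiplied by isometries.
theorem gnsNorm_bondSum_mul_X_sub_le (F : Finset ℤ) (n : ℤ) (h1 : n ∈ F) (h2 : n + 1 ∈ F) :
    gnsNorm ω (bondSum t c Z X F * X (n + 1) - (X (n + 1) - (c : ℂ) • X n - (c : ℂ) • X (n + 1 + 1)))
      ≤ (1 / 2 + |c| + |t| / 2) * (gnsNorm ω (wall Z n) + gnsNorm ω (wall Z (n + 1))) := by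
  have hP : ∀ n, gnsNorm ω (bond t c Z X n) = 0 := fun n => by
    simp [gnsNorm, (h.isStarProjection_bond htc n).isSelfAdjoint.star_eq,
      (h.isStarProjection_bond htc n).isIdempotentElem.eq, h0]
  have hF : bondSum t c Z X F * X (n + 1) = ∑ k ∈ (F.erase n).erase (n + 1),
      X (n + 1) * bond t c Z X k + (bond t c Z X n + bond t c Z X (n + 1)) * X (n + 1) := by
    rw [bondSum, ← Finset.add_sum_erase F _ h1, ← Finset.add_sum_erase (F.erase n) _
      (Finset.mem_erase.2 ⟨by omega, h2⟩), add_mul, add_mul, Finset.sum_mul, add_mul]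
    rw [Finset.sum_congr rfl fun k hk => (h.bond_commute_X (t := t) (c := c) (x := n + 1)
      (n := k) (Finset.ne_of_mem_erase hk).symm (fun hh => Finset.ne_of_mem_erase
        (Finset.mem_of_mem_erase hk) (by omega))).eq]
    abel
  have hz : gnsNorm ω (∑ k ∈ (F.erase n).erase (n + 1), X (n + 1) * bond t c Z X k) ≤ 0 := by
    refine (gnsNorm_sum_le hω _ _).trans (Finset.sum_nonpos fun k _ => ?_)
    rw [h.gnsNorm_X_mul hω, hP]
  rw [hF, add_sub_assoc, h.bond_add_bond_mul_X]
  refine (gnsNorm_add_le hω _ _).trans ?_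
  have three : ∀ (u v s : ℂ) (A B C : R), gnsNorm ω (u • A + v • B + s • C) ≤
      ‖u‖ * gnsNorm ω A + ‖v‖ * gnsNorm ω B + ‖s‖ * gnsNorm ω C := fun u v s A B C => by
    rw [← gnsNorm_smul hω, ← gnsNorm_smul hω, ← gnsNorm_smul hω]
    exact (gnsNorm_add_le hω _ _).trans (add_le_add_left (gnsNorm_add_le hω _ _) _)
  have b := gnsNorm_add_le hω
    ((-1 / 2 : ℂ) • (X (n + 1) * wall Z n) + (c : ℂ) • (X n * wall Z n)
      + (t / 2 : ℂ) • (X (n + 1) * (Z n * wall Z n)))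
    ((-1 / 2 : ℂ) • (X (n + 1) * wall Z (n + 1)) + (c : ℂ) • (X (n + 1 + 1) * wall Z (n + 1))
      + (t / 2 : ℂ) • (X (n + 1) * (Z (n + 1) * wall Z (n + 1))))
  have b1 := three (-1 / 2) c (t / 2) (X (n + 1) * wall Z n) (X n * wall Z n)
    (X (n + 1) * (Z n * wall Z n))
  have b2 := three (-1 / 2) c (t / 2) (X (n + 1) * wall Z (n + 1)) (X (n + 1 + 1) * wall Z (n + 1))
    (X (n + 1) * (Z (n + 1) * wall Z (n + 1)))
  simp only [h.gnsNorm_X_mul hω, h.gnsNorm_Z_mul hω] at b1 b2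
  have n1 : ‖(-1 / 2 : ℂ)‖ = 1 / 2 := by norm_num
  have n2 : ‖(t / 2 : ℂ)‖ = |t| / 2 := by simp
  rw [n1, n2, Complex.norm_real, Real.norm_eq_abs] at b1 b2
  linarith

include htc hω1 h0 in
-- One application of `H` replaces the index set `T` by `T × {-1, 0, 1}`. Coinciding positions are
-- not merged, so the step iterates directly; `F m` has to contain both bonds at every site of the
-- wave.
theorem tendsto_gnsNorm_bondSum_mul_wave (ht : 0 < t) {J : Type*} (T : Finset J) (w : J → ℝ)
    (pos : J → ℤ) (F : ℤ → Finset ℤ)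
    (hF : ∀ m, ∀ j ∈ T, m + pos j - 1 ∈ F m ∧ m + pos j ∈ F m) :
    Tendsto (fun m => gnsNorm ω (bondSum t c Z X (F m) * wave X T w pos m -
      wave X (T ×ˢ ({-1, 0, 1} : Finset ℤ)) (fun p => w p.1 * hopAmp c p.2)
        (fun p => pos p.1 + p.2) m)) atTop (𝓝 0) := by
  set D : ℤ → ℝ := fun x => (1 / 2 + |c| + |t| / 2) *
    (gnsNorm ω (wall Z (x - 1)) + gnsNorm ω (wall Z x)) with hD
  have hDlim : Tendsto D atTop (𝓝 0) := by
    have hw := tendsto_gnsNorm_wall h htc hω hω1 h0 ht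
    have hw' := hw.comp (tendsto_atTop_add_const_right atTop (-1 : ℤ) tendsto_id)
    simpa [hD, Function.comp_def, sub_eq_add_neg] using
      (hw'.add hw).const_mul (1 / 2 + |c| + |t| / 2)
  have hlim : Tendsto (fun m => ∑ j ∈ T, |w j| * D (m + pos j)) atTop (𝓝 0) := by
    have : Tendsto (fun m => ∑ j ∈ T, |w j| * D (m + pos j)) atTop (𝓝 (∑ j ∈ T, |w j| * 0)) :=
      tendsto_finsetSum _ fun j _ => Tendsto.const_mul _
        (hDlim.comp (tendsto_atTop_add_const_right atTop (pos j) tendsto_id))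
    simpa using this
  refine squeeze_zero (fun m => gnsNorm_nonneg _) (fun m => ?_) hlim
  have e : bondSum t c Z X (F m) * wave X T w pos m -
      wave X (T ×ˢ ({-1, 0, 1} : Finset ℤ)) (fun p => w p.1 * hopAmp c p.2)
        (fun p => pos p.1 + p.2) m =
      ∑ j ∈ T, (w j : ℂ) • (bondSum t c Z X (F m) * X (m + pos j - 1 + 1) -
        (X (m + pos j - 1 + 1) - (c : ℂ) • X (m + pos j - 1)
          - (c : ℂ) • X (m + pos j - 1 + 1 + 1))) := by
    simp only [wave, Finset.sum_product, Finset.mul_sum, ← Finset.sum_sub_distrib]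
    refine Finset.sum_congr rfl fun j _ => ?_
    rw [Finset.sum_insert (by decide), Finset.sum_insert (by decide), Finset.sum_singleton]
    have e1 : hopAmp c (-1) = -c := by simp [hopAmp]
    have e2 : hopAmp c 0 = 1 := by simp [hopAmp]
    have e3 : hopAmp c 1 = -c := by simp [hopAmp]
    have f1 : m + (pos j + -1) = m + pos j - 1 := by ring
    have f2 : m + (pos j + 1) = m + pos j + 1 := by ring
    simp only [e1, e2, e3, f1, f2, sub_add_cancel, add_zero, mul_smul_comm]
    push_cast
    module
  rw [e]
  refine (gnsNorm_sum_le hω _ _).trans (Finset.sum_le_sum fun j hj => ?_)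
  rw [gnsNorm_smul hω, Complex.norm_real, Real.norm_eq_abs]
  refine mul_le_mul_of_nonneg_left ?_ (abs_nonneg _)
  have := gnsNorm_bondSum_mul_X_sub_le h htc hω h0 (F m) (m + pos j - 1) (hF m j hj).1
    (by rw [sub_add_cancel]; exact (hF m j hj).2)
  simpa only [hD, sub_add_cancel] using this

include htc hω1 h0 in
/-- The spin waves far from the domain walls have energies arbitrarily close to `1 - 2 c`. -/
theorem gap_le (ht : 0 < t) (hc : 2 * c < 1) {γ : ℝ}
    (hγ : ∀ (s F : Finset ℤ), (∀ x ∈ s, ∀ y, |y - x| ≤ 2 → y ∈ F) →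
      γ * gnsNorm ω (bondSum t c Z X F * ∑ x ∈ s, X x) ^ 2 ≤
      (ω (star (bondSum t c Z X F * ∑ x ∈ s, X x) *
        (bondSum t c Z X F * (bondSum t c Z X F * ∑ x ∈ s, X x)))).re) :
    γ ≤ 1 - 2 * c := by
  set B : Finset ℤ := {-1, 0, 1} with hB
  -- The limit `m → ∞` of the gap inequality at fixed `N`: the left side counts coincidences between
  -- two once-hopped waves, the right side between a once-hopped and a twice-hopped one.
  have key : ∀ N : ℕ,
      γ * (∑ b ∈ B, ∑ b' ∈ B, hopAmp c b * hopAmp c b' *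
        ∑ k ∈ Finset.range N, ∑ k' ∈ Finset.range N,
          (if (k : ℤ) + b = k' + b' then (1 : ℝ) else 0)) ≤
      ∑ b ∈ B, ∑ b' ∈ B, ∑ b'' ∈ B, hopAmp c b * hopAmp c b' * hopAmp c b'' *
        ∑ k ∈ Finset.range N, ∑ k' ∈ Finset.range N,
          (if (k : ℤ) + b = k' + (b' + b'') then (1 : ℝ) else 0) := by
    intro N
    -- The window covers the neighbourhood required by `hγ` and the bonds at all sites reached after
    -- one hop. Its cardinality `N + 7` does not depend on `m`, which bounds `H` uniformly.
    set F : ℤ → Finset ℤ := fun m => Finset.Icc (m - 3) (m + N + 3) with hF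
    set w₀ : ℕ → ℝ := fun _ => 1
    set p₀ : ℕ → ℤ := fun k => k
    set T₀ := Finset.range N
    set T₁ := T₀ ×ˢ B
    set w₁ : ℕ × ℤ → ℝ := fun p => w₀ p.1 * hopAmp c p.2
    set p₁ : ℕ × ℤ → ℤ := fun p => p₀ p.1 + p.2
    set T₂ := T₁ ×ˢ B
    set w₂ : (ℕ × ℤ) × ℤ → ℝ := fun p => w₁ p.1 * hopAmp c p.2
    set p₂ : (ℕ × ℤ) × ℤ → ℤ := fun p => p₁ p.1 + p.2
    have hB1 : ∀ b ∈ B, -1 ≤ b ∧ b ≤ 1 := by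
      intro b hb
      simp only [hB, Finset.mem_insert, Finset.mem_singleton] at hb
      omega
    have l1 := tendsto_gnsNorm_bondSum_mul_wave h htc hω hω1 h0 ht T₀ w₀ p₀ F (by
      intro m j hj
      simp only [T₀, Finset.mem_range] at hj
      simp only [hF, Finset.mem_Icc, p₀]
      omega)
    have l2 := tendsto_gnsNorm_bondSum_mul_wave h htc hω hω1 h0 ht T₁ w₁ p₁ F (by
      intro m j hj
      simp only [T₁, T₀, Finset.mem_product, Finset.mem_range] at hj
      have := hB1 _ hj.2
      simp only [hF, Finset.mem_Icc, p₁, p₀]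
      omega)
    change Tendsto (fun m => gnsNorm ω (bondSum t c Z X (F m) * wave X T₀ w₀ p₀ m -
      wave X T₁ w₁ p₁ m)) atTop (𝓝 0) at l1
    change Tendsto (fun m => gnsNorm ω (bondSum t c Z X (F m) * wave X T₁ w₁ p₁ m -
      wave X T₂ w₂ p₂ m)) atTop (𝓝 0) at l2
    have hcard : ∀ m, ((F m).card : ℝ) = N + 7 := fun m => by
      have : (F m).card = N + 7 := by
        simp only [hF, Int.card_Icc]
        omega
      exact_mod_cast this
    have l3 : Tendsto (fun m => gnsNorm ω (bondSum t c Z X (F m) *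
        (bondSum t c Z X (F m) * wave X T₀ w₀ p₀ m) - wave X T₂ w₂ p₂ m)) atTop (𝓝 0) := by
      refine squeeze_zero (fun m => gnsNorm_nonneg _) (fun m => ?_)
        (by simpa using (l1.const_mul (N + 7 : ℝ)).add l2)
      have e : bondSum t c Z X (F m) * (bondSum t c Z X (F m) * wave X T₀ w₀ p₀ m)
          - wave X T₂ w₂ p₂ m = bondSum t c Z X (F m) *
            (bondSum t c Z X (F m) * wave X T₀ w₀ p₀ m - wave X T₁ w₁ p₁ m)
          + (bondSum t c Z X (F m) * wave X T₁ w₁ p₁ m - wave X T₂ w₂ p₂ m) := by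
        rw [mul_sub]
        abel
      rw [e]
      refine (gnsNorm_add_le hω _ _).trans (add_le_add_left ?_ _)
      rw [← hcard m]
      exact gnsNorm_bondSum_mul_le h htc hω _ _
    have C1 : ∀ m, gnsNorm ω (wave X T₁ w₁ p₁ m) ≤ max (∑ j ∈ T₁, |w₁ j|) (∑ j ∈ T₂, |w₂ j|) :=
      fun m => (gnsNorm_wave_le h hω hω1 _ _ _ _).trans (le_max_left _ _)
    have C2 : ∀ m, gnsNorm ω (wave X T₂ w₂ p₂ m) ≤ max (∑ j ∈ T₁, |w₁ j|) (∑ j ∈ T₂, |w₂ j|) :=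
      fun m => (gnsNorm_wave_le h hω hω1 _ _ _ _).trans (le_max_right _ _)
    have a1 := tendsto_apply_star_mul hω l1 l1 C1 C1
      (tendsto_apply_star_wave_mul_wave h htc hω hω1 h0 ht T₁ w₁ p₁ T₁ w₁ p₁)
    have a2 := tendsto_apply_star_mul hω l1 l3 C1 C2
      (tendsto_apply_star_wave_mul_wave h htc hω hω1 h0 ht T₁ w₁ p₁ T₂ w₂ p₂)
    have r1 := ((Complex.continuous_re.tendsto _).comp a1).const_mul γ
    have r2 := (Complex.continuous_re.tendsto _).comp a2
    have fin := le_of_tendsto_of_tendsto' r1 r2 (fun m => by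
      have hs : wave X T₀ w₀ p₀ m = ∑ x ∈ T₀.image (fun k : ℕ => m + (k : ℤ)), X x := by
        rw [Finset.sum_image (fun a _ b _ hab => by simpa using hab)]
        simp [wave, w₀, p₀]
      have := hγ (T₀.image (fun k : ℕ => m + (k : ℤ))) (F m) (by
        intro x hx y hy
        simp only [T₀, Finset.mem_image, Finset.mem_range] at hx
        obtain ⟨k, hk, rfl⟩ := hx
        rw [abs_le] at hy
        simp only [hF, Finset.mem_Icc]
        omega)
      rw [← hs, gnsNorm_sq hω] at this
      exact this)
    simp only [Complex.ofReal_re] at fin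
    have c1 : (∑ b ∈ B, ∑ b' ∈ B, hopAmp c b * hopAmp c b' * ∑ k ∈ T₀, ∑ k' ∈ T₀,
          (if (k : ℤ) + b = k' + b' then (1 : ℝ) else 0)) =
        ∑ j ∈ T₁, ∑ j' ∈ T₁, w₁ j * w₁ j' * if p₁ j = p₁ j' then 1 else 0 := by
      simp only [T₁, Finset.sum_product, Finset.mul_sum, w₁, w₀, p₁, p₀, one_mul]
      rw [Finset.sum_comm (s := T₀)]
      refine Finset.sum_congr rfl fun b _ => ?_
      rw [Finset.sum_comm]
      exact Finset.sum_congr rfl fun k _ => Finset.sum_comm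
    have c2 : (∑ b ∈ B, ∑ b' ∈ B, ∑ b'' ∈ B, hopAmp c b * hopAmp c b' * hopAmp c b'' *
          ∑ k ∈ T₀, ∑ k' ∈ T₀, (if (k : ℤ) + b = k' + (b' + b'') then (1 : ℝ) else 0)) =
        ∑ j ∈ T₁, ∑ j' ∈ T₂, w₁ j * w₂ j' * if p₁ j = p₂ j' then 1 else 0 := by
      simp only [T₁, T₂, Finset.sum_product, Finset.mul_sum, w₂, w₁, w₀, p₂, p₁, p₀, one_mul,
        ← mul_assoc, add_assoc]
      rw [Finset.sum_comm (s := T₀)]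
      refine Finset.sum_congr rfl fun b _ => ?_
      rw [Finset.sum_congr rfl fun b' _ => Finset.sum_comm, Finset.sum_comm]
      refine Finset.sum_congr rfl fun k _ => ?_
      rw [Finset.sum_congr rfl fun b' _ => Finset.sum_comm, Finset.sum_comm]
    rw [c1, c2]
    exact fin
  have lim1 : Tendsto (fun N : ℕ => γ * (∑ b ∈ B, ∑ b' ∈ B, hopAmp c b * hopAmp c b' *
        ((∑ k ∈ Finset.range N, ∑ k' ∈ Finset.range N,
          (if (k : ℤ) + b = k' + b' then (1 : ℝ) else 0)) / N))) atTop
      (𝓝 (γ * (∑ b ∈ B, ∑ b' ∈ B, hopAmp c b * hopAmp c b' * 1))) :=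
    Tendsto.const_mul _ (tendsto_finsetSum _ fun b _ => tendsto_finsetSum _ fun b' _ =>
      Tendsto.const_mul _ (tendsto_coincidences b b'))
  have lim2 : Tendsto (fun N : ℕ => ∑ b ∈ B, ∑ b' ∈ B, ∑ b'' ∈ B,
        hopAmp c b * hopAmp c b' * hopAmp c b'' *
        ((∑ k ∈ Finset.range N, ∑ k' ∈ Finset.range N,
          (if (k : ℤ) + b = k' + (b' + b'') then (1 : ℝ) else 0)) / N)) atTop
      (𝓝 (∑ b ∈ B, ∑ b' ∈ B, ∑ b'' ∈ B, hopAmp c b * hopAmp c b' * hopAmp c b'' * 1)) :=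
    tendsto_finsetSum _ fun b _ => tendsto_finsetSum _ fun b' _ =>
      tendsto_finsetSum _ fun b'' _ => Tendsto.const_mul _ (tendsto_coincidences b (b' + b''))
  -- After division by `N` every coincidence count tends to one, so the sums factor into powers of
  -- the total hopping amplitude: `γ (1 - 2c)² ≤ (1 - 2c)³`.
  have fin := le_of_tendsto_of_tendsto' lim1 lim2 (fun N => by
    have := div_le_div_of_nonneg_right (key N) (Nat.cast_nonneg (α := ℝ) N)
    simpa only [mul_div_assoc, Finset.sum_div] using this)
  have s := sum_hopAmp c
  simp only [mul_one, ← Finset.mul_sum, ← Finset.sum_mul, ← hB] at fin s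
  rw [s] at fin
  have hp : 0 < (1 - 2 * c) * (1 - 2 * c) := mul_pos (by linarith) (by linarith)
  refine le_of_mul_le_mul_right ?_ hp
  linarith

end SpinWave

/-! ### Local observables as operators -/

theorem overwrite_apply_mem {Λ : Finset ℤ} (τ : Λ → Fin 2) (σ : ℤ → Fin 2) (x : Λ) :
    overwrite τ σ x = τ x := by simp [overwrite]

theorem overwrite_apply_notMem {Λ : Finset ℤ} (τ : Λ → Fin 2) (σ : ℤ → Fin 2) {x : ℤ}
    (hx : x ∉ Λ) : overwrite τ σ x = σ x := by simp [overwrite, hx]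

theorem overwrite_overwrite {Λ : Finset ℤ} (τ τ' : Λ → Fin 2) (σ : ℤ → Fin 2) :
    overwrite τ' (overwrite τ σ) = overwrite τ' σ := by
  funext x
  by_cases hx : x ∈ Λ <;> simp [overwrite, hx]

theorem overwrite_self {Λ : Finset ℤ} (σ : ℤ → Fin 2) :
    overwrite (fun x : Λ => σ x) σ = σ := by
  funext x
  by_cases hx : x ∈ Λ <;> simp [overwrite, hx]

theorem overwrite_injective {Λ : Finset ℤ} (σ : ℤ → Fin 2) :
    Function.Injective fun τ : Λ → Fin 2 => overwrite τ σ := by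
  intro τ τ' e
  funext x
  rw [← overwrite_apply_mem τ σ x, ← overwrite_apply_mem τ' σ x]
  exact congrFun e x

theorem localOp_apply {Λ : Finset ℤ} (A : LocalMatrix Λ) (ψ : ConfigSpace) (σ : ℤ → Fin 2) :
    localOp Λ A ψ σ = ∑ τ, A (fun x => σ x) τ * ψ (overwrite τ σ) := by
  have e : ∀ ρ τ : Λ → Fin 2, matrixUnit ρ τ ψ σ =
      if (fun x : Λ => σ x) = ρ then ψ (overwrite τ σ) else 0 := fun _ _ => rfl
  simp only [localOp, _root_.sum_apply, _root_.smul_apply, lp.coeFn_sum,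
    Finset.sum_apply, lp.coeFn_smul, Pi.smul_apply, smul_eq_mul, e]
  rw [Finset.sum_comm]
  simp

theorem localOp_mul {Λ : Finset ℤ} (A B : LocalMatrix Λ) :
    localOp Λ (A * B) = localOp Λ A * localOp Λ B := by
  ext ψ σ
  simp only [mul_apply_eq_comp, localOp_apply, overwrite_apply_mem,
    overwrite_overwrite, Matrix.mul_apply, Finset.sum_mul, Finset.mul_sum, mul_assoc]
  exact Finset.sum_comm

theorem localOp_one (Λ : Finset ℤ) : localOp Λ 1 = 1 := by
  ext ψ σ
  simp [localOp_apply, Matrix.one_apply, overwrite_self]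

open Classical in
theorem localOp_single {Λ : Finset ℤ} (A : LocalMatrix Λ) (ρ τ : Λ → Fin 2) :
    localOp Λ A (lp.single 2 (overwrite τ 0) 1) (overwrite ρ 0) = A ρ τ := by
  rw [localOp_apply]
  simp only [overwrite_overwrite, overwrite_apply_mem, lp.single_apply]
  rw [Finset.sum_eq_single τ]
  · simp
  · intro τ' _ hne
    have : overwrite τ' 0 ≠ overwrite τ 0 := fun e => hne (overwrite_injective 0 e)
    simp [this]
  · simp

/-- Matrix entries are recovered on configurations that are up outside `Λ`. Faithfulness lets
identities between matrices, also of different volumes, be checked as identities between Pauli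
operators. -/
theorem localOp_injective (Λ : Finset ℤ) : Function.Injective (localOp Λ) := by
  intro A B hAB
  ext ρ τ
  rw [← localOp_single A, ← localOp_single B, hAB]

theorem localOp_extend {Λ Λ' : Finset ℤ} (h : Λ ⊆ Λ') (A : LocalMatrix Λ) :
    localOp Λ' (extend h A) = localOp Λ A := by
  ext ψ σ
  rw [localOp_apply, localOp_apply]
  simp only [extend, ite_mul, zero_mul]
  rw [← Finset.sum_filter]
  refine Finset.sum_nbij' (fun τ' => restrict h τ') (fun τ y => overwrite τ σ y) ?_ ?_ ?_ ?_ ?_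
  · simp
  · intro τ _
    simp only [Finset.mem_filter, Finset.mem_univ, true_and]
    exact fun y hy => (overwrite_apply_notMem τ σ hy).symm
  · intro τ' hτ'
    simp only [Finset.mem_filter, Finset.mem_univ, true_and] at hτ'
    funext y
    by_cases hy : (y : ℤ) ∈ Λ
    · simp [overwrite, hy, restrict]
    · simp [overwrite, hy, hτ' y hy]
  · intro τ _
    funext x
    exact overwrite_apply_mem τ σ x
  · intro τ' hτ'
    simp only [Finset.mem_filter, Finset.mem_univ, true_and] at hτ'
    refine congrArg₂ _ rfl (congrArg ψ ?_)
    funext y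
    by_cases hy : y ∈ Λ
    · simp [overwrite, hy, h hy, restrict]
    · by_cases hy' : y ∈ Λ'
      · simp [overwrite, hy, hy', ← hτ' ⟨y, hy'⟩ hy]
      · simp [overwrite, hy, hy']

theorem localOp_atSite {Λ : Finset ℤ} (x : Λ) (M : Matrix (Fin 2) (Fin 2) ℂ) (ψ : ConfigSpace)
    (σ : ℤ → Fin 2) :
    localOp Λ (atSite x M) ψ σ = ∑ b, M (σ x) b * ψ (Function.update σ x b) := by
  rw [localOp_apply]
  simp only [atSite, ite_mul, zero_mul]
  rw [← Finset.sum_filter]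
  refine Finset.sum_nbij' (fun τ => τ x) (fun b => Function.update (fun y : Λ => σ y) x b)
    ?_ ?_ ?_ ?_ ?_
  · simp
  · intro b _
    simp only [Finset.mem_filter, Finset.mem_univ, true_and]
    exact fun y hy => by simp [hy]
  · intro τ hτ
    simp only [Finset.mem_filter, Finset.mem_univ, true_and] at hτ
    funext y
    by_cases hy : y = x
    · subst hy
      simp
    · simp [hy, hτ y hy]
  · simp
  · intro τ hτ
    simp only [Finset.mem_filter, Finset.mem_univ, true_and] at hτ
    refine congrArg₂ _ rfl (congrArg ψ ?_)
    funext y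
    by_cases hy : y ∈ Λ
    · by_cases hyx : y = x
      · subst hyx
        simp [overwrite]
      · have := hτ ⟨y, hy⟩ (fun e => hyx (congrArg Subtype.val e))
        simp [overwrite, hy, hyx, ← this]
    · have hyx : y ≠ x := fun e => hy (e ▸ x.2)
      simp [overwrite, hy, hyx]

/-- The configuration with the spin at `x` flipped. -/
def flipAt (x : ℤ) (σ : ℤ → Fin 2) : ℤ → Fin 2 := Function.update σ x (σ x + 1)

/-- The eigenvalue of `σ³` on a basis state. -/
noncomputable def spinSign (b : Fin 2) : ℂ := if b = 0 then 1 else -1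

theorem spinSign_mul_self (b : Fin 2) : spinSign b * spinSign b = 1 := by
  unfold spinSign
  split_ifs <;> simp

theorem spinSign_add_one (b : Fin 2) : spinSign (b + 1) = -spinSign b := by
  fin_cases b <;> simp [spinSign]

theorem conj_spinSign (b : Fin 2) : (starRingEnd ℂ) (spinSign b) = spinSign b := by
  unfold spinSign
  split_ifs <;> simp

theorem flipAt_self (x : ℤ) (σ : ℤ → Fin 2) : flipAt x σ x = σ x + 1 := by simp [flipAt]

theorem flipAt_of_ne {x y : ℤ} (h : y ≠ x) (σ : ℤ → Fin 2) : flipAt x σ y = σ y := by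
  simp [flipAt, h]

theorem flipAt_flipAt (x : ℤ) (σ : ℤ → Fin 2) : flipAt x (flipAt x σ) = σ := by
  have : ∀ b : Fin 2, b + 1 + 1 = b := by decide
  simp [flipAt, this]

theorem flipAt_comm (x y : ℤ) (σ : ℤ → Fin 2) :
    flipAt x (flipAt y σ) = flipAt y (flipAt x σ) := by
  by_cases h : x = y
  · rw [h]
  · unfold flipAt
    rw [Function.update_of_ne h, Function.update_of_ne (Ne.symm h), Function.update_comm h]

/-- `σ³` at the site `x`. -/
noncomputable def opZ (x : ℤ) : ConfigSpace →L[ℂ] ConfigSpace :=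
  localOp {x} (atSite ⟨x, Finset.mem_singleton_self x⟩ !![1, 0; 0, -1])

/-- `σ¹` at the site `x`. -/
noncomputable def opX (x : ℤ) : ConfigSpace →L[ℂ] ConfigSpace :=
  localOp {x} (atSite ⟨x, Finset.mem_singleton_self x⟩ !![0, 1; 1, 0])

theorem opZ_apply (x : ℤ) (ψ : ConfigSpace) (σ : ℤ → Fin 2) :
    opZ x ψ σ = spinSign (σ x) * ψ σ := by
  rw [opZ, localOp_atSite, Fin.sum_univ_two]
  have h : ∀ b : Fin 2, σ x = b → Function.update σ x b = σ := fun b hb => by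
    rw [← hb, Function.update_eq_self]
  rcases Fin.exists_fin_two.1 ⟨σ x, rfl⟩ with h0 | h0
  · simp [h0, spinSign, h _ h0]
  · simp [h0, spinSign, h _ h0]

theorem opX_apply (x : ℤ) (ψ : ConfigSpace) (σ : ℤ → Fin 2) :
    opX x ψ σ = ψ (flipAt x σ) := by
  rw [opX, localOp_atSite, Fin.sum_univ_two]
  rcases Fin.exists_fin_two.1 ⟨σ x, rfl⟩ with h0 | h0
  · simp [h0, flipAt]
  · simp [h0, flipAt]

theorem star_opZ (x : ℤ) : star (opZ x) = opZ x := by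
  rw [ContinuousLinearMap.star_eq_adjoint]
  refine ((ContinuousLinearMap.eq_adjoint_iff _ _).2 fun ψ φ => ?_).symm
  rw [lp.inner_eq_tsum, lp.inner_eq_tsum]
  refine tsum_congr fun σ => ?_
  rw [opZ_apply, opZ_apply]
  simp [conj_spinSign]
  ring

theorem star_opX (x : ℤ) : star (opX x) = opX x := by
  rw [ContinuousLinearMap.star_eq_adjoint]
  refine ((ContinuousLinearMap.eq_adjoint_iff _ _).2 fun ψ φ => ?_).symm
  rw [lp.inner_eq_tsum, lp.inner_eq_tsum,
    ← (Function.Involutive.toPerm (flipAt x) (flipAt_flipAt x)).tsum_eq]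
  refine tsum_congr fun σ => ?_
  change inner ℂ (opX x ψ (flipAt x σ)) (φ (flipAt x σ)) = inner ℂ (ψ σ) (opX x φ σ)
  rw [opX_apply, opX_apply, flipAt_flipAt]

theorem isPauli_op : IsPauli opZ opX where
  Z_sq x := by
    ext ψ σ
    simp only [mul_apply_eq_comp, opZ_apply, ← mul_assoc, spinSign_mul_self]
    simp
  X_sq x := by
    ext ψ σ
    simp [opX_apply, flipAt_flipAt]
  anticomm x := by
    ext ψ σ
    simp only [mul_apply_eq_comp, _root_.neg_apply, lp.coeFn_neg,
      Pi.neg_apply, opZ_apply, opX_apply, flipAt_self, spinSign_add_one]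
    ring
  Z_comm x y := by
    ext ψ σ
    simp only [mul_apply_eq_comp, opZ_apply]
    ring
  X_comm x y := by
    ext ψ σ
    simp only [mul_apply_eq_comp, opX_apply]
    rw [flipAt_comm]
  X_Z_comm x y hxy := by
    ext ψ σ
    simp only [mul_apply_eq_comp, opX_apply, opZ_apply, flipAt_of_ne hxy.symm]
  star_Z := star_opZ
  star_X := star_opX

theorem opZ_commute_localOp {Λ : Finset ℤ} {x : ℤ} (hx : x ∉ Λ) (A : LocalMatrix Λ) :
    Commute (opZ x) (localOp Λ A) := by
  ext ψ σ
  simp only [mul_apply_eq_comp, opZ_apply, localOp_apply,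
    overwrite_apply_notMem _ _ hx, Finset.mul_sum]
  exact Finset.sum_congr rfl fun τ _ => by ring

theorem opX_commute_localOp {Λ : Finset ℤ} {x : ℤ} (hx : x ∉ Λ) (A : LocalMatrix Λ) :
    Commute (opX x) (localOp Λ A) := by
  ext ψ σ
  simp only [mul_apply_eq_comp, opX_apply, localOp_apply]
  have e1 : (fun y : Λ => flipAt x σ y) = fun y : Λ => σ y := by
    funext y
    exact flipAt_of_ne (fun e : (y : ℤ) = x => hx (e ▸ y.2)) σ
  rw [e1]
  refine Finset.sum_congr rfl fun τ _ => ?_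
  refine congrArg₂ _ rfl (congrArg ψ ?_)
  funext y
  by_cases hy : y = x
  · subst hy
    rw [overwrite_apply_notMem _ _ hx, flipAt_self, flipAt_self, overwrite_apply_notMem _ _ hx]
  · by_cases hy' : y ∈ Λ <;> simp [overwrite, hy', flipAt_of_ne hy]

theorem localOp_add {Λ : Finset ℤ} (A B : LocalMatrix Λ) :
    localOp Λ (A + B) = localOp Λ A + localOp Λ B := by
  simp [localOp, add_smul, Finset.sum_add_distrib]

theorem localOp_smul {Λ : Finset ℤ} (r : ℂ) (A : LocalMatrix Λ) :
    localOp Λ (r • A) = r • localOp Λ A := by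
  simp [localOp, Finset.smul_sum, smul_smul]

/-- The inclusion of the observables of `Λ` in the bounded operators. -/
noncomputable def localHom (Λ : Finset ℤ) : LocalMatrix Λ →ₐ[ℂ] (ConfigSpace →L[ℂ] ConfigSpace) :=
  AlgHom.ofLinearMap ⟨⟨localOp Λ, localOp_add⟩, localOp_smul⟩ (localOp_one Λ) localOp_mul

theorem localHom_apply (Λ : Finset ℤ) (A : LocalMatrix Λ) : localHom Λ A = localOp Λ A := rfl

theorem localOp_atSite_S3 {Λ : Finset ℤ} (x : Λ) :
    localOp Λ (atSite x S3) = (1 / 2 : ℂ) • opZ x := by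
  ext ψ σ
  rw [localOp_atSite, opZ, _root_.smul_apply, lp.coeFn_smul, Pi.smul_apply,
    localOp_atSite, smul_eq_mul, Fin.sum_univ_two, Fin.sum_univ_two]
  rcases Fin.exists_fin_two.1 ⟨σ x, rfl⟩ with h0 | h0 
  · simp [h0, S3]
  · simp [h0, S3]
    ring

theorem localOp_atSite_S1 {Λ : Finset ℤ} (x : Λ) :
    localOp Λ (atSite x S1) = (1 / 2 : ℂ) • opX x := by
  ext ψ σ
  rw [localOp_atSite, opX, _root_.smul_apply, lp.coeFn_smul, Pi.smul_apply,
    localOp_atSite, smul_eq_mul, Fin.sum_univ_two, Fin.sum_univ_two]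
  rcases Fin.exists_fin_two.1 ⟨σ x, rfl⟩ with h0 | h0 <;> simp [h0, S1]

theorem localOp_atSite_S2 {Λ : Finset ℤ} (x : Λ) :
    localOp Λ (atSite x S2) = (Complex.I / 2) • (opX x * opZ x) := by
  ext ψ σ
  rw [localOp_atSite, _root_.smul_apply, lp.coeFn_smul, Pi.smul_apply,
    mul_apply_eq_comp, opX_apply, opZ_apply, smul_eq_mul, Fin.sum_univ_two,
    flipAt_self, flipAt]
  rcases Fin.exists_fin_two.1 ⟨σ x, rfl⟩ with h0 | h0 
  · simp [h0, S2, spinSign]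
    ring
  · simp [h0, S2, spinSign]

/-- As `S² = (i/2) σ¹σ³`, the sum `S¹S¹ + S²S²` over two sites is half the double flip restricted to
walls. -/
theorem localOp_interaction (ξ : ℝ) {Λ : Finset ℤ} (x y : Λ) (hxy : (y : ℤ) = x + 1) :
    localOp Λ (interaction ξ x y) =
      bond (Real.tanh ξ) (1 / (2 * Real.cosh ξ)) opZ opX x - (1 / 4 : ℂ) • 1 := by
  have e : opX x * opZ x * (opX y * opZ y) = opX x * opX y * (opZ x * opZ y) := by
    rw [mul_assoc, ← mul_assoc (opZ x), ← isPauli_op.X_Z_comm y x (by omega)]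
    simp only [mul_assoc]
  have hc : ((1 / Real.cosh ξ : ℝ) : ℂ) = 2 * ((1 / (2 * Real.cosh ξ) : ℝ) : ℂ) := by
    have := (Real.cosh_pos ξ).ne'
    norm_cast
    field_simp
  have h1 := localOp_atSite_S1 x
  have h2 := localOp_atSite_S2 x
  have h3 := localOp_atSite_S3 x
  have h1' := localOp_atSite_S1 y
  have h2' := localOp_atSite_S2 y
  have h3' := localOp_atSite_S3 y
  rw [isPauli_op.bond_eq, ← hxy, ← localHom_apply]
  simp only [interaction, map_add, map_sub, map_smul, map_mul, localHom_apply, h1, h2, h3, h1',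
    h2', h3', mul_smul_comm, smul_mul_assoc, e, mul_sub, mul_one]
  rw [Complex.ofReal_sub, hc]
  have hI : Complex.I / 2 * (Complex.I / 2) = -(1 / 4) := by
    linear_combination Complex.I_mul_I / 4
  simp only [smul_smul, hI]
  push_cast
  module

/-! ### Finite volume ground states -/

theorem conjTranspose_atSite {Λ : Finset ℤ} (x : Λ) {M : Matrix (Fin 2) (Fin 2) ℂ}
    (hM : M.IsHermitian) : (atSite x M).conjTranspose = atSite x M := by
  ext ρ τ
  simp only [Matrix.conjTranspose_apply, atSite]
  have e : (∀ y, y ≠ x → τ y = ρ y) ↔ ∀ y, y ≠ x → ρ y = τ y :=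
    ⟨fun h y hy => (h y hy).symm, fun h y hy => (h y hy).symm⟩
  simp only [e, apply_ite star, star_zero, hM.apply]

theorem atSite_mul_comm {Λ : Finset ℤ} {x y : Λ} (hxy : x ≠ y) (M N : Matrix (Fin 2) (Fin 2) ℂ) :
    atSite x M * atSite y N = atSite y N * atSite x M := by
  apply localOp_injective
  have hxy' : (x : ℤ) ≠ y := fun e => hxy (Subtype.ext e)
  ext ψ σ
  simp only [localOp_mul, mul_apply_eq_comp, localOp_atSite, Finset.mul_sum,
    Function.update_of_ne hxy', Function.update_of_ne hxy'.symm]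
  rw [Finset.sum_comm]
  refine Finset.sum_congr rfl fun b _ => Finset.sum_congr rfl fun b' _ => ?_
  rw [Function.update_comm hxy']
  ring

theorem isHermitian_S1 : S1.IsHermitian := by
  ext i j
  fin_cases i <;> fin_cases j <;> simp [S1]

theorem isHermitian_S2 : S2.IsHermitian := by
  ext i j
  fin_cases i <;> fin_cases j <;> simp [S2]

theorem isHermitian_S3 : S3.IsHermitian := by
  ext i j
  fin_cases i <;> fin_cases j <;> simp [S3]

theorem isHermitian_interaction (ξ : ℝ) {Λ : Finset ℤ} {x y : Λ} (hxy : x ≠ y) :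
    (interaction ξ x y).IsHermitian := by
  simp only [Matrix.IsHermitian, interaction, Matrix.conjTranspose_add, Matrix.conjTranspose_sub,
    Matrix.conjTranspose_smul, Matrix.conjTranspose_mul, conjTranspose_atSite _ isHermitian_S1,
    conjTranspose_atSite _ isHermitian_S2, conjTranspose_atSite _ isHermitian_S3,
    atSite_mul_comm hxy, star_neg, Complex.star_def, Complex.conj_ofReal]

/-- The interaction of `x` and `y` shifted to have ground state energy zero. -/
noncomputable def bondMatrix (ξ : ℝ) {Λ : Finset ℤ} (x y : Λ) : LocalMatrix Λ :=
  interaction ξ x y + (1 / 4 : ℂ) • 1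

section BondMatrix

variable (ξ : ℝ) {Λ : Finset ℤ} {x y : Λ} (hxy : (y : ℤ) = x + 1)
include hxy

theorem localOp_bondMatrix : localOp Λ (bondMatrix ξ x y) =
    bond (Real.tanh ξ) (1 / (2 * Real.cosh ξ)) opZ opX x := by
  rw [bondMatrix, localOp_add, localOp_smul, localOp_one, localOp_interaction ξ x y hxy]
  abel

omit hxy in
theorem tanh_sq_add (ξ : ℝ) : Real.tanh ξ ^ 2 + 4 * (1 / (2 * Real.cosh ξ)) ^ 2 = 1 := by
  have := (Real.cosh_pos ξ).ne'
  rw [Real.tanh_eq_sinh_div_cosh]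
  field_simp
  linarith [Real.cosh_sq ξ]

theorem conjTranspose_mul_bondMatrix :
    (bondMatrix ξ x y).conjTranspose * bondMatrix ξ x y = bondMatrix ξ x y := by
  have hne : x ≠ y := fun e => by
    rw [e] at hxy
    omega
  have h1 : (bondMatrix ξ x y).conjTranspose = bondMatrix ξ x y := by
    rw [bondMatrix, Matrix.conjTranspose_add, (isHermitian_interaction ξ hne).eq]
    simp
  rw [h1]
  apply localOp_injective
  rw [localOp_mul, localOp_bondMatrix ξ hxy]
  exact isPauli_op.isIdempotentElem_bond (tanh_sq_add ξ) x

theorem inner_bondMatrix (φ : LocalSpace Λ) :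
    inner ℂ φ (Matrix.toEuclideanLin (bondMatrix ξ x y) φ) =
      ((‖Matrix.toEuclideanLin (bondMatrix ξ x y) φ‖ ^ 2 : ℝ) : ℂ) := by
  conv_lhs => rw [← conjTranspose_mul_bondMatrix ξ hxy]
  rw [Matrix.toLpLin_mul_same, LinearMap.comp_apply, Matrix.toEuclideanLin_conjTranspose_eq_adjoint,
    LinearMap.adjoint_inner_right, inner_self_eq_norm_sq_to_K]
  push_cast
  rfl

theorem bondMatrix_up_up : bondMatrix ξ x y 0 0 = 0 := by
  classical
  rw [← localOp_single (bondMatrix ξ x y) 0 0, localOp_bondMatrix ξ hxy,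
    ← isPauli_op.bond_mul_wall, mul_apply_eq_comp]
  have e : wall opZ x (lp.single 2 (overwrite (0 : Λ → Fin 2) 0) 1) = 0 := by
    have e0 : overwrite (0 : Λ → Fin 2) 0 = 0 := by
      funext z
      simp [overwrite]
    rw [e0]
    ext σ
    simp only [wall, _root_.smul_apply, _root_.sub_apply, mul_apply_eq_comp, lp.coeFn_smul,
      lp.coeFn_sub, Pi.smul_apply, Pi.sub_apply, opZ_apply, lp.single_apply]
    by_cases hσ : σ = 0
    · subst hσ
      simp [spinSign]
    · simp [hσ]
  rw [e, map_zero]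
  rfl

end BondMatrix

theorem inner_hamiltonian (ξ : ℝ) {Λ : Finset ℤ} (φ : LocalSpace Λ) :
    (inner ℂ φ (Matrix.toEuclideanLin (hamiltonian ξ Λ) φ)).re =
      (∑ x : Λ, if hx : (x : ℤ) + 1 ∈ Λ then
        ‖Matrix.toEuclideanLin (bondMatrix ξ x ⟨(x : ℤ) + 1, hx⟩) φ‖ ^ 2 else 0)
      - (∑ x : Λ, if (x : ℤ) + 1 ∈ Λ then (1 / 4 : ℝ) else 0) * ‖φ‖ ^ 2 := by
  rw [hamiltonian, map_sum, LinearMap.sum_apply, inner_sum, Complex.re_sum, Finset.sum_mul,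
    ← Finset.sum_sub_distrib]
  refine Finset.sum_congr rfl fun x _ => ?_
  by_cases hx : (x : ℤ) + 1 ∈ Λ
  · simp only [hx, dif_pos, if_true]
    have e : interaction ξ x ⟨(x : ℤ) + 1, hx⟩ =
        bondMatrix ξ x ⟨(x : ℤ) + 1, hx⟩ - (1 / 4 : ℂ) • 1 := by
      rw [bondMatrix]
      abel
    rw [e, map_sub, map_smul, LinearMap.sub_apply, LinearMap.smul_apply, inner_sub_right,
      inner_bondMatrix ξ rfl, inner_smul_right, Matrix.toLpLin_one, LinearMap.id_apply,
      inner_self_eq_norm_sq_to_K, Complex.sub_re, Complex.ofReal_re]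
    congr 1
    rw [show (1 / 4 : ℂ) = ((1 / 4 : ℝ) : ℂ) by norm_num, Complex.re_ofReal_mul]
    congr 1
    norm_cast
  · simp [hx]

/-- Ground states of finite volumes are frustration-free. -/
theorem IsGroundVector.bondMatrix_eq_zero {ξ : ℝ} {Λ : Finset ℤ} {ψ : LocalSpace Λ}
    (hψ : IsGroundVector ξ Λ ψ) (x : Λ) (hx : (x : ℤ) + 1 ∈ Λ) :
    Matrix.toEuclideanLin (bondMatrix ξ x ⟨(x : ℤ) + 1, hx⟩) ψ = 0 := by
  obtain ⟨h1, E, hE, hmin⟩ := hψ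
  -- The all-up vector as trial state: a vanishing diagonal entry of a projection means that it
  -- annihilates the vector. Hence `E` is at most `-1/4` per bond, and the sum of squares in the
  -- energy of `ψ` must vanish.
  set e₀ : LocalSpace Λ := EuclideanSpace.single 0 1 with he₀
  have hup := hmin e₀
  have hn : ‖e₀‖ = 1 := by simp [he₀]
  have hzero : ∀ (x : Λ) (hx : (x : ℤ) + 1 ∈ Λ),
      ‖Matrix.toEuclideanLin (bondMatrix ξ x ⟨(x : ℤ) + 1, hx⟩) e₀‖ ^ 2 = 0 := by
    intro x hx
    have := inner_bondMatrix ξ (x := x) (y := ⟨(x : ℤ) + 1, hx⟩) rfl e₀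
    rw [he₀, EuclideanSpace.inner_single_left] at this
    simp [bondMatrix_up_up] at this
    rw [he₀]
    exact_mod_cast this.symm
  rw [inner_hamiltonian, hn] at hup
  simp only [hzero, dite_eq_ite, ite_self, Finset.sum_const_zero] at hup
  have hen := inner_hamiltonian ξ ψ
  rw [hE, inner_smul_right, inner_self_eq_norm_sq_to_K, h1] at hen
  simp only [Complex.coe_algebraMap, Complex.ofReal_one, one_pow, mul_one,
    Complex.ofReal_re] at hen
  have hnn : ∀ x ∈ (Finset.univ : Finset Λ), 0 ≤ (if hx : (x : ℤ) + 1 ∈ Λ then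
        ‖Matrix.toEuclideanLin (bondMatrix ξ x ⟨(x : ℤ) + 1, hx⟩) ψ‖ ^ 2 else 0) := by
    intro x _
    split_ifs <;> positivity
  have hs : (∑ x : Λ, if hx : (x : ℤ) + 1 ∈ Λ then
        ‖Matrix.toEuclideanLin (bondMatrix ξ x ⟨(x : ℤ) + 1, hx⟩) ψ‖ ^ 2 else 0) = 0 :=
    le_antisymm (by linarith) (Finset.sum_nonneg hnn)
  have := (Finset.sum_eq_zero_iff_of_nonneg hnn).1 hs x (Finset.mem_univ x)
  rw [dif_pos hx] at this
  simpa using this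

theorem IsGroundVector.expectation_bondMatrix {ξ : ℝ} {V : Finset ℤ} {ψ : LocalSpace V}
    (hψ : IsGroundVector ξ V ψ) {Λ : Finset ℤ} (x y : Λ) (hxy : (y : ℤ) = x + 1) (h : Λ ⊆ V) :
    expectation ψ (bondMatrix ξ x y) = 0 := by
  have hy : (x : ℤ) + 1 ∈ V := hxy ▸ h y.2
  have e : extend h (bondMatrix ξ x y) =
      bondMatrix ξ (Λ := V) ⟨x, h x.2⟩ ⟨(x : ℤ) + 1, hy⟩ := by
    apply localOp_injective
    rw [localOp_extend, localOp_bondMatrix ξ hxy, localOp_bondMatrix ξ rfl]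
  rw [expectation, dif_pos h, e, hψ.bondMatrix_eq_zero ⟨x, h x.2⟩ hy, inner_zero_right]

/-! ### The derivation on local observables -/

/-- `σ³` at the site `x` as a quasilocal observable. -/
noncomputable def obsZ (x : ℤ) : quasilocal :=
  localObs {x} (atSite ⟨x, Finset.mem_singleton_self x⟩ !![1, 0; 0, -1])

/-- `σ¹` at the site `x` as a quasilocal observable. -/
noncomputable def obsX (x : ℤ) : quasilocal :=
  localObs {x} (atSite ⟨x, Finset.mem_singleton_self x⟩ !![0, 1; 1, 0])

theorem isPauli_obs : IsPauli obsZ obsX where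
  Z_sq x := Subtype.ext (isPauli_op.Z_sq x)
  X_sq x := Subtype.ext (isPauli_op.X_sq x)
  anticomm x := Subtype.ext (isPauli_op.anticomm x)
  Z_comm x y := Subtype.ext (isPauli_op.Z_comm x y)
  X_comm x y := Subtype.ext (isPauli_op.X_comm x y)
  X_Z_comm x y h := Subtype.ext (isPauli_op.X_Z_comm x y h)
  star_Z x := Subtype.ext (isPauli_op.star_Z x)
  star_X x := Subtype.ext (isPauli_op.star_X x)

/-- The projection `h(n, n + 1) + 1/4` as a quasilocal observable. -/
noncomputable abbrev obsBond (ξ : ℝ) (n : ℤ) : quasilocal :=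
  bond (Real.tanh ξ) (1 / (2 * Real.cosh ξ)) obsZ obsX n

/-- The sum of `obsBond` over a finite set of bonds. -/
noncomputable abbrev obsBondSum (ξ : ℝ) (F : Finset ℤ) : quasilocal :=
  bondSum (Real.tanh ξ) (1 / (2 * Real.cosh ξ)) obsZ obsX F

theorem localObs_bondMatrix (ξ : ℝ) {Λ : Finset ℤ} {x y : Λ} (hxy : (y : ℤ) = x + 1) :
    localObs Λ (bondMatrix ξ x y) = obsBond ξ x :=
  Subtype.ext (localOp_bondMatrix ξ hxy)

theorem localObs_hamiltonian (ξ : ℝ) (Λ : Finset ℤ) :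
    localObs Λ (hamiltonian ξ Λ) = obsBondSum ξ {x ∈ Λ | x + 1 ∈ Λ}
      - ((({x ∈ Λ | x + 1 ∈ Λ} : Finset ℤ).card : ℂ) * (1 / 4)) • 1 := by
  have e : ∀ x : Λ, localHom Λ (if hx : (x : ℤ) + 1 ∈ Λ then
        interaction ξ x ⟨(x : ℤ) + 1, hx⟩ else 0) =
      if (x : ℤ) + 1 ∈ Λ then bond (Real.tanh ξ) (1 / (2 * Real.cosh ξ)) opZ opX x
        - (1 / 4 : ℂ) • 1 else 0 := by
    intro x
    split_ifs with hx
    · rw [localHom_apply, localOp_interaction ξ _ _ rfl]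
    · exact map_zero _
  apply Subtype.ext
  change localHom Λ (hamiltonian ξ Λ) = _
  rw [hamiltonian, map_sum]
  simp only [e]
  rw [Finset.sum_coe_sort Λ (fun x => if x + 1 ∈ Λ then
    bond (Real.tanh ξ) (1 / (2 * Real.cosh ξ)) opZ opX x - (1 / 4 : ℂ) • 1 else 0),
    ← Finset.sum_filter, Finset.sum_sub_distrib, Finset.sum_const, ← Nat.cast_smul_eq_nsmul ℂ,
    smul_smul]
  exact congrArg₂ (· - ·) (map_sum quasilocal.subtype (obsBond ξ) _).symm rfl

theorem commutator_bondSum_of_subset (ξ : ℝ) {F G : Finset ℤ} (hFG : F ⊆ G) {A : quasilocal}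
    (hA : ∀ n ∉ F, Commute (obsBond ξ n) A) :
    obsBondSum ξ G * A - A * obsBondSum ξ G = obsBondSum ξ F * A - A * obsBondSum ξ F := by
  simp only [obsBondSum, bondSum, Finset.sum_mul, Finset.mul_sum, ← Finset.sum_sub_distrib]
  refine (Finset.sum_subset hFG fun n _ hn => ?_).symm
  rw [(hA n hn).eq, sub_self]

/-- Once `Λ` contains both ends of every bond in `F`, its Hamiltonian differs from the sum over `F`
by a scalar and by bonds commuting with `A`; the net of commutators is eventually constant. -/
theorem derivation_eq (ξ : ℝ) {F : Finset ℤ} {A : quasilocal}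
    (hA : ∀ n ∉ F, Commute (obsBond ξ n) A) :
    derivation ξ A = obsBondSum ξ F * A - A * obsBondSum ξ F := by
  refine Tendsto.limUnder_eq (tendsto_const_nhds.congr' ?_)
  filter_upwards [eventually_ge_atTop (F ∪ F.image (· + 1))] with Λ hΛ
  have hsub : F ⊆ ({x ∈ Λ | x + 1 ∈ Λ} : Finset ℤ) := fun n hn =>
    Finset.mem_filter.2 ⟨hΛ (Finset.mem_union_left _ hn),
      hΛ (Finset.mem_union_right _ (Finset.mem_image_of_mem _ hn))⟩
  rw [localObs_hamiltonian, ← commutator_bondSum_of_subset ξ hsub hA]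
  simp only [sub_mul, mul_sub, smul_mul_assoc, mul_smul_comm, one_mul, mul_one]
  abel

theorem obsBond_commute_localObs (ξ : ℝ) {Λ : Finset ℤ} {n : ℤ} (h1 : n ∉ Λ) (h2 : n + 1 ∉ Λ)
    (A : LocalMatrix Λ) : Commute (obsBond ξ n) (localObs Λ A) :=
  bond_commute isPauli_obs (Subtype.ext (opZ_commute_localOp h1 A))
    (Subtype.ext (opZ_commute_localOp h2 A)) (Subtype.ext (opX_commute_localOp h1 A))
    (Subtype.ext (opX_commute_localOp h2 A))

/-- A single `F` must serve both derivatives, since the gap estimates compare powers of one `H`. The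
derivative of a local observable involves only the bonds with left end in `Λ ∪ (Λ - 1)`, and bonds
starting further than 2 from `Λ` commute with these and with `A`. -/
theorem derivation_localObs (ξ : ℝ) {Λ F : Finset ℤ} (hF : ∀ x ∈ Λ, ∀ y, |y - x| ≤ 2 → y ∈ F)
    (A : LocalMatrix Λ) :
    derivation ξ (localObs Λ A) = obsBondSum ξ F * localObs Λ A - localObs Λ A * obsBondSum ξ F ∧
    derivation ξ (derivation ξ (localObs Λ A)) =
      obsBondSum ξ F * (obsBondSum ξ F * localObs Λ A - localObs Λ A * obsBondSum ξ F) -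
        (obsBondSum ξ F * localObs Λ A - localObs Λ A * obsBondSum ξ F) * obsBondSum ξ F := by
  set F₀ := Λ ∪ Λ.image (· - 1) with hF₀
  have near : ∀ m ∈ F₀, ∃ x ∈ Λ, x - 1 ≤ m ∧ m ≤ x := by
    intro m hm
    simp only [hF₀, Finset.mem_union, Finset.mem_image] at hm
    rcases hm with hm | ⟨x, hx, rfl⟩
    · exact ⟨m, hm, by omega, le_rfl⟩
    · exact ⟨x, hx, le_rfl, by omega⟩
  have hsub : F₀ ⊆ F := fun m hm => by
    obtain ⟨x, hx, h1, h2⟩ := near m hm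
    exact hF x hx m (abs_le.2 (by omega))
  have hcomm : ∀ n ∉ F₀, Commute (obsBond ξ n) (localObs Λ A) := by
    intro n hn
    simp only [hF₀, Finset.mem_union, Finset.mem_image, not_or] at hn
    exact obsBond_commute_localObs ξ hn.1 (fun h => hn.2 ⟨n + 1, h, by omega⟩) A
  have e := commutator_bondSum_of_subset ξ hsub hcomm
  have e1 := derivation_eq ξ (fun n hn => hcomm n fun h => hn (hsub h))
  refine ⟨e1, ?_⟩
  rw [e1]
  refine derivation_eq ξ fun n hn => ?_
  rw [e]
  have hc : Commute (obsBond ξ n) (obsBondSum ξ F₀) := by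
    refine Commute.sum_right _ _ _ fun m hm => ?_
    obtain ⟨x, hx, h1, h2⟩ := near m hm
    have far : ¬|n - x| ≤ 2 := fun h => hn (hF x hx n h)
    rw [abs_le] at far
    exact isPauli_obs.bond_commute_bond (by omega) (by omega) (by omega)
  have hA := hcomm n fun h => hn (hsub h)
  exact (hc.mul_right hA).sub_right (hA.mul_right hc)

theorem exists_neighbourhood (Λ : Finset ℤ) :
    ∃ F : Finset ℤ, ∀ x ∈ Λ, ∀ y, |y - x| ≤ 2 → y ∈ F :=
  ⟨Λ.biUnion fun x => Finset.Icc (x - 2) (x + 2), fun x hx y hy =>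
    Finset.mem_biUnion.2 ⟨x, hx, by rw [abs_le] at hy; rw [Finset.mem_Icc]; omega⟩⟩

/-- Sums of spin flips are local. -/
theorem exists_localObs_eq_sum_obsX (s : Finset ℤ) :
    ∃ A : LocalMatrix s, localObs s A = ∑ x ∈ s, obsX x := by
  refine ⟨∑ x : s, (2 : ℂ) • atSite x S1, Subtype.ext ?_⟩
  change localHom s _ = _
  simp only [map_sum, map_smul, localHom_apply, localOp_atSite_S1, smul_smul,
    AddSubmonoidClass.coe_finsetSum]
  norm_num
  exact Finset.sum_coe_sort s opX

/-! ### The gap of frustration-free states -/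

section Gap

variable {ξ : ℝ} {ω : quasilocal →ₗ[ℂ] ℂ}

theorem IsState.isGroundState (hω : IsState ω) (h0 : ∀ n, ω (obsBond ξ n) = 0) :
    IsGroundState ξ ω := by
  refine ⟨hω, fun Λ A => ?_⟩
  obtain ⟨F, hF⟩ := exists_neighbourhood Λ
  rw [(derivation_localObs ξ hF A).1,
    apply_mul_commutator isPauli_obs (tanh_sq_add ξ) hω.1 h0]
  exact apply_bondSum_nonneg isPauli_obs (tanh_sq_add ξ) hω.1 F _

theorem IsState.isSpectralGap (hξ : 0 < ξ) (hω : IsState ω) (h0 : ∀ n, ω (obsBond ξ n) = 0) :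
    IsSpectralGap ξ ω (1 - 1 / Real.cosh ξ) := by
  have hcosh : 1 < Real.cosh ξ := Real.one_lt_cosh.2 hξ.ne'
  have hc0 : 0 < 1 / (2 * Real.cosh ξ) := by positivity
  have hc : 2 * (1 / (2 * Real.cosh ξ)) = 1 / Real.cosh ξ := by
    field_simp
  have hc1 : 2 * (1 / (2 * Real.cosh ξ)) < 1 := by
    rw [hc, div_lt_one (by linarith)]
    exact hcosh
  have ht : 0 < Real.tanh ξ := by
    rw [Real.tanh_eq_sinh_div_cosh]
    exact div_pos (Real.sinh_pos_iff.2 hξ) (by linarith)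
  have htc := tanh_sq_add ξ
  rw [← hc]
  refine ⟨fun Λ A => ?_, fun γ hγ => ?_⟩
  · obtain ⟨F, hF⟩ := exists_neighbourhood Λ
    rw [(derivation_localObs ξ hF A).2, (derivation_localObs ξ hF A).1,
      apply_star_commutator_mul_commutator isPauli_obs htc hω.1 h0,
      apply_star_commutator_mul_commutator₂ isPauli_obs htc hω.1 h0,
      apply_bondSum isPauli_obs htc hω.1,
      ← Complex.ofReal_mul, Complex.real_le_real]
    have := bondSum_cube_ge isPauli_obs htc hω.1 hc0.le hc1.le F (localObs Λ A)
    rwa [apply_bondSum isPauli_obs htc hω.1, Complex.ofReal_re] at this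
  · refine gap_le isPauli_obs htc hω.1 hω.2 h0 ht hc1 fun s F hF => ?_
    obtain ⟨A, hA⟩ := exists_localObs_eq_sum_obsX s
    have := hγ s A
    rw [(derivation_localObs ξ hF A).2, (derivation_localObs ξ hF A).1,
      apply_star_commutator_mul_commutator isPauli_obs htc hω.1 h0,
      apply_star_commutator_mul_commutator₂ isPauli_obs htc hω.1 h0, ← Complex.ofReal_mul] at this
    rw [← hA]
    exact (Complex.le_def.1 this).1

end Gap

end XXZ

/-! ### Passage to the infinite-volume limit -/

theorem proposition3p1 (ξ : ℝ) (hξ : 0 < ξ)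
    {ι : Type*} (l : Filter ι) [l.NeBot] (a b : ι → ℤ)
    (ha : Filter.Tendsto a l Filter.atBot) (hb : Filter.Tendsto b l Filter.atTop)
    (ψ : ∀ i, XXZ.LocalSpace (Finset.Icc (a i) (b i)))
    (hψ : ∀ i, XXZ.IsGroundVector ξ (Finset.Icc (a i) (b i)) (ψ i))
    (ω : XXZ.quasilocal →ₗ[ℂ] ℂ) (hω : XXZ.IsState ω)
    (hlim : XXZ.IsWeakStarLimit l (fun i => Finset.Icc (a i) (b i)) ψ ω) :
    XXZ.IsGroundState ξ ω ∧ XXZ.IsSpectralGap ξ ω (1 - 1 / Real.cosh ξ) := by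
  have h0 : ∀ n, ω (XXZ.obsBond ξ n) = 0 := by
    intro n
    have hn : n ∈ Finset.Icc n (n + 1) := Finset.mem_Icc.2 ⟨le_rfl, by omega⟩
    have hn' : n + 1 ∈ Finset.Icc n (n + 1) := Finset.mem_Icc.2 ⟨by omega, le_rfl⟩
    have lim := hlim (Finset.Icc n (n + 1)) (XXZ.bondMatrix ξ ⟨n, hn⟩ ⟨n + 1, hn'⟩)
    rw [XXZ.localObs_bondMatrix ξ rfl] at lim
    -- Eventually the volume contains both `n` and `n + 1`, and there the expectation of the
    -- projection is exactly zero.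
    refine tendsto_nhds_unique lim (tendsto_const_nhds.congr' ?_)
    filter_upwards [ha.eventually_le_atBot n, hb.eventually_ge_atTop (n + 1)] with i hai hbi
    exact ((hψ i).expectation_bondMatrix _ _ rfl (Finset.Icc_subset_Icc hai hbi)).symm
  exact ⟨hω.isGroundState h0, hω.isSpectralGap hξ h0⟩
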